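/- Let $q$ be a prime power and let $\mathrm{Sym}_q(m)$ be the $\mathbb F_q$-vector space of symmetric $m\times m$ matrices over $\mathbb F_q$, with the rank distance $d(A,B)=\mathrm{rk}(A-B)$. A symmetric rank-metric code of order $m$ is an $\mathbb F_q$-subspace $C\subseteq \mathrm{Sym}_q(m)$; for $C\neq\{0\}$ its minimum distance is $d(C)=\min\{d(A,B): A,B\in C,\ A\neq B\}$. Let $B_t$ be the number of matrices in $\mathrm{Sym}_q(m)$ of rank at most $t$ (the size of a ball of radius $t$). The covering density of $C\ne\{0\}$ is $$D(C)=\frac{|C|\,B_t}{q^{(m^2+m)/2}},\qquad t=\left\lfloor \frac{d(C)-1}{2}\right\rfloor .$$ A family $\{C_i\}_{i\in\mathbb N}$ of nonzero symmetric rank-metric codes over $\mathbb F_q$, where $C_i\subseteq\mathrm{Sym}_q(m_i)$ and all the $C_i$ have the same minimum distance $d$, is quasi-perfect if $\lim_{i\to\infty}D(C_i)=1$. A nonzero code $C\subseteq\mathrm{Sym}_q(m)$ with $d=d(C)$ is a symmetric MRD code if $\dim C=\frac{m(m-d+2)}{2}$ when $m-d$ is even, and $\dim C=\frac{(m+1)(m-d+1)}{2}$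 when $m-d$ is odd. **Corollary.** For every prime power $q$: 1. There is a quasi-perfect family of symmetric rank-metric codes over $\mathbb F_q$ with minimum distance $d$ if and only if $d\in\{1,3\}$. 2. If $\{C_i\}_i$ is a quasi-perfect family with minimum distance $3$, then $m_i$ is even for only finitely many indices $i$. 3. For every odd $m\ge 3$ there is a symmetric MRD code in $\mathrm{Sym}_q(m)$ with minimum distance $3$, and every family of symmetric MRD codes over $\mathbb F_q$ of odd orders with minimum distance $3$ is quasi-perfect. -/

import Mathlib

namespace SymRank

/-- `Sym_q(m)`: the space of symmetric `m × m` matrices over `F`. -/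
def symMatrices (F : Type*) [Field F] (m : ℕ) : Submodule F (Matrix (Fin m) (Fin m) F) where
  carrier := {A | A.IsSymm}
  add_mem' hA hB := hA.add hB
  zero_mem' := Matrix.isSymm_zero
  smul_mem' c _ hA := hA.smul c

/-- A symmetric rank-metric code of order `m`: an `F`-subspace of `Sym_q(m)`. -/
abbrev SymCode (F : Type*) [Field F] (m : ℕ) : Type _ := Submodule F (symMatrices F m)

/-- The rank distance `d(A, B) = rk (A - B)`. -/
noncomputable def rankDist {F : Type*} [Field F] {m : ℕ} (A B : symMatrices F m) : ℕ :=
  ((A : Matrix (Fin m) (Fin m) F) - (B : Matrix (Fin m) (Fin m) F)).rank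

/-- The minimum distance `d(C)`: the least distance of two distinct codewords.
It is meaningful when `C` has at least two codewords, that is, when `C ≠ ⊥`. -/
noncomputable def minDist {F : Type*} [Field F] {m : ℕ} (C : SymCode F m) : ℕ :=
  sInf {r : ℕ | ∃ A ∈ C, ∃ B ∈ C, A ≠ B ∧ rankDist A B = r}

/-- The sphere of radius `t` centred in `M`. -/
def sphere {F : Type*} [Field F] {m : ℕ} (M : symMatrices F m) (t : ℕ) : Set (symMatrices F m) :=
  {N | rankDist M N = t}

/-- The ball of radius `t` centred in `M`: the union of the spheres of radius `0, …, t`. -/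
def ball {F : Type*} [Field F] {m : ℕ} (M : symMatrices F m) (t : ℕ) : Set (symMatrices F m) :=
  ⋃ i ∈ Finset.range (t + 1), sphere M i

/-- `B_t`: the number of elements of a ball of radius `t` in `Sym_q(m)`, here the one centred
in `0`; by `ncard_ball` the centre does not matter. -/
noncomputable def ballSize (F : Type*) [Field F] (m t : ℕ) : ℕ :=
  (ball (0 : symMatrices F m) t).ncard

theorem ncard_ball {F : Type*} [Field F] {m : ℕ} (M : symMatrices F m) (t : ℕ) :
    (ball M t).ncard = ballSize F m t := by
  have h : ball M t = (fun N => N + M) '' ball (0 : symMatrices F m) t := by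
    ext N
    simp only [ball, sphere, rankDist, Set.mem_iUnion, Set.mem_ofPred_eq, Set.mem_image]
    constructor
    · rintro ⟨i, hi, h⟩
      refine ⟨N - M, ⟨i, hi, ?_⟩, by simp⟩
      rw [← h]
      congr 1
      simp
    · rintro ⟨K, ⟨i, hi, h⟩, rfl⟩
      refine ⟨i, hi, ?_⟩
      rw [← h]
      congr 1
      simp
  rw [h, Set.ncard_image_of_injective _ (add_left_injective M)]
  rfl

/-- The covering density `D(C) = |C| * B_t / q ^ ((m ^ 2 + m) / 2)` with
`t = ⌊(d(C) - 1) / 2⌋`. -/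
noncomputable def coveringDensity {F : Type*} [Field F] {m : ℕ} (C : SymCode F m) : ℝ :=
  ((Nat.card C : ℝ) * (ballSize F m ((minDist C - 1) / 2) : ℝ)) /
    (Nat.card F : ℝ) ^ ((m ^ 2 + m) / 2)

/-- The Singleton-like bound for the dimension of a code in `Sym_q(m)` with minimum distance `d`
(used with `d ≤ m`; the divisions by two are exact). -/
def singletonBound (m d : ℕ) : ℕ :=
  if Even (m - d) then m * (m - d + 2) / 2 else (m + 1) * (m - d + 1) / 2

/-- A symmetric MRD code: a code whose parameters attain the Singleton-like bound. -/
def IsSymMRD {F : Type*} [Field F] {m : ℕ} (C : SymCode F m) : Prop :=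
  C ≠ ⊥ ∧ Module.finrank F C = singletonBound m (minDist C)

/-- A family `{C_i}_i` of symmetric rank-metric codes over `F`, with `C_i` of order `m_i`, all
having the same minimum distance `d`. -/
structure CodeFamily (F : Type*) [Field F] (d : ℕ) where
  order : ℕ → ℕ
  code : ∀ i : ℕ, SymCode F (order i)
  code_ne_bot : ∀ i : ℕ, code i ≠ ⊥
  minDist_code : ∀ i : ℕ, minDist (code i) = d

/-- A family is quasi-perfect if the covering densities of its codes tend to `1`. -/
def CodeFamily.IsQuasiPerfect {F : Type*} [Field F] {d : ℕ} (C : CodeFamily F d) : Prop :=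
  Filter.Tendsto (fun i : ℕ => coveringDensity (C.code i)) Filter.atTop (nhds 1)

end SymRank

/-! Write `q` for the size of the field and `t` for the radius. The covering density is a power of
`q` times a ball size, so the proof rests on how close a ball size can come to a power of `q`.

For `t ≥ 2`, building symmetric matrices by bordering gives a recursion for ball sizes
(`ballSize_succ_add_two`). Divided by the leading power of `q`, the ball size is at least a constant
above 1 and at most a constant below 2, uniformly over orders `m > t`. As `q ≥ 2`, no power of `q`
brings it near 1 (`exists_le_abs_pow_mul_ballSize_sub_one`), which excludes `d ≥ 5`.

For `t ≤ 1` the density is itself an integer power of `q`, so a limit of 1 means that the codes are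
eventually perfect. For `d = 2` the code would be the whole space, which contains matrices of rank
one. A perfect code with `t = 1` has distance at most 3 (`minDist_le_three`), so `d = 4` fails.

For `d = 3` and odd `m`, take the field `L` of degree `m` over `F` with Frobenius `σ`, and the
kernel of `A ↦ ∑ A i j • (b i * σ (b j))`. It has codimension at most `m` and no nonzero element of
rank at most 2, so it is perfect by sphere packing.

For `d = 3` and even `m`, let `C` be perfect and `W` the quotient of the symmetric matrices by `C`,
of dimension `m`. Relations in `W` between matrices `x xᵀ`, or involving one `x yᵀ + y xᵀ`, lift
because `C` has no nonzero element of rank at most 2. In odd characteristic, squaring is then a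
bijection between the lines of `F^m` and those of `W`, so a nondegenerate quadratic form in `m`
variables would have exactly `q^(m-1)` zeros, impossible for even `m`. In characteristic two, `x ↦
[x xᵀ]` is a bijection onto `W`, so each nonzero functional on `W` gives an alternating form with
nonzero radical, of dimension at least 2 by parity. A double count of radicals gives the
contradiction. -/

namespace SymRank

open Matrix

/-! ### Bordered symmetric matrices -/

section Border

variable {F : Type*} {m n : ℕ}

/-- Appending a row on top of a matrix. -/
def consRow (x : Fin n → F) (M : Matrix (Fin m) (Fin n) F) : Matrix (Fin (m + 1)) (Fin n) F :=
  Matrix.of (Fin.cons x M)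

/-- The matrix with first row `(a, v)`, first column `(a, v)` and lower right block `A`. -/
def border (A : Matrix (Fin m) (Fin m) F) (v : Fin m → F) (a : F) :
    Matrix (Fin (m + 1)) (Fin (m + 1)) F :=
  consRow (Fin.cons a v) (consRow v Aᵀ)ᵀ

@[simp] theorem border_zero_zero (A : Matrix (Fin m) (Fin m) F) (v : Fin m → F) (a : F) :
    border A v a 0 0 = a := rfl

@[simp] theorem border_zero_succ (A : Matrix (Fin m) (Fin m) F) (v : Fin m → F) (a : F)
    (j : Fin m) : border A v a 0 j.succ = v j := rfl

@[simp] theorem border_succ_zero (A : Matrix (Fin m) (Fin m) F) (v : Fin m → F) (a : F)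
    (i : Fin m) : border A v a i.succ 0 = v i := rfl

@[simp] theorem border_succ_succ (A : Matrix (Fin m) (Fin m) F) (v : Fin m → F) (a : F)
    (i j : Fin m) : border A v a i.succ j.succ = A i j := rfl

theorem isSymm_border {A : Matrix (Fin m) (Fin m) F} (hA : A.IsSymm) (v : Fin m → F) (a : F) :
    (border A v a).IsSymm := by
  refine IsSymm.ext fun i j => ?_
  refine Fin.cases ?_ (fun i => ?_) i <;> refine Fin.cases ?_ (fun j => ?_) j <;>
    simp [hA.apply]

theorem border_self {M : Matrix (Fin (m + 1)) (Fin (m + 1)) F} (hM : M.IsSymm) :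
    border (M.submatrix Fin.succ Fin.succ) (fun j => M 0 j.succ) (M 0 0) = M := by
  ext i j
  refine Fin.cases ?_ (fun i => ?_) i <;> refine Fin.cases ?_ (fun j => ?_) j <;>
    simp [hM.apply]

variable [Field F]

theorem rank_consRow_of_mem {x : Fin n → F} {M : Matrix (Fin m) (Fin n) F}
    (h : ∃ w, w ᵥ* M = x) : (consRow x M).rank = M.rank := by
  rw [rank_eq_finrank_span_row, rank_eq_finrank_span_row]
  have hr : Set.range (consRow x M).row = insert x (Set.range M.row) := by
    exact Fin.range_cons x M
  rw [hr, Submodule.span_insert_eq_span]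
  obtain ⟨w, rfl⟩ := h
  rw [← range_vecMulLinear]
  exact ⟨w, rfl⟩

theorem rank_consRow_of_notMem {x : Fin n → F} {M : Matrix (Fin m) (Fin n) F}
    (h : ¬ ∃ w, w ᵥ* M = x) : (consRow x M).rank = M.rank + 1 := by
  rw [rank_eq_finrank_span_row, rank_eq_finrank_span_row]
  have hr : Set.range (consRow x M).row = insert x (Set.range M.row) := by
    exact Fin.range_cons x M
  have hx : x ∉ Submodule.span F (Set.range M.row) := by
    rw [← range_vecMulLinear]
    exact h
  have hx0 : x ≠ 0 := fun h0 => hx (h0 ▸ Submodule.zero_mem _)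
  rw [hr, Submodule.span_insert, sup_comm]
  have hd : Disjoint (Submodule.span F (Set.range M.row)) (F ∙ x) :=
    (Submodule.disjoint_span_singleton' hx0).2 hx
  have := Submodule.finrank_sup_add_finrank_inf_eq (Submodule.span F (Set.range M.row)) (F ∙ x)
  rw [hd.eq_bot, finrank_bot, finrank_span_singleton hx0] at this
  simpa using this

theorem vecMul_consRow_transpose (w v : Fin m → F) (A : Matrix (Fin m) (Fin m) F) :
    w ᵥ* (consRow v Aᵀ)ᵀ = Fin.cons (w ⬝ᵥ v) (w ᵥ* A) := by
  funext j
  exact Fin.cases rfl (fun j => rfl) j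

/-- For `v = w ᵥ* A`, row and column operations with `w` clear the border and leave the corner `a -
w ⬝ᵥ (w ᵥ* A)`, so the rank grows by 0 or 1. A border outside the row space adds one to the row rank
and one to the column rank. -/
theorem rank_border_of_mem_of_eq {A : Matrix (Fin m) (Fin m) F} (hA : A.IsSymm)
    (w : Fin m → F) : (border A (w ᵥ* A) (w ⬝ᵥ (w ᵥ* A))).rank = A.rank := by
  rw [border, rank_consRow_of_mem, rank_transpose, rank_consRow_of_mem, rank_transpose]
  · exact ⟨w, by rw [hA.eq]⟩
  · exact ⟨w, vecMul_consRow_transpose _ _ _⟩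

theorem rank_border_of_mem_of_ne {A : Matrix (Fin m) (Fin m) F} (hA : A.IsSymm)
    (w : Fin m → F) {a : F} (ha : a ≠ w ⬝ᵥ (w ᵥ* A)) :
    (border A (w ᵥ* A) a).rank = A.rank + 1 := by
  rw [border, rank_consRow_of_notMem, rank_transpose, rank_consRow_of_mem, rank_transpose]
  · exact ⟨w, by rw [hA.eq]⟩
  · rintro ⟨u, hu⟩
    rw [vecMul_consRow_transpose, Fin.cons_inj] at hu
    apply ha
    rw [← hu.1, ← dotProduct_comm, ← dotProduct_mulVec, ← vecMul_transpose, hA.eq, hu.2]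

theorem rank_border_of_notMem {A : Matrix (Fin m) (Fin m) F} (hA : A.IsSymm)
    {v : Fin m → F} (hv : ¬ ∃ w, w ᵥ* A = v) (a : F) : (border A v a).rank = A.rank + 2 := by
  rw [border, rank_consRow_of_notMem, rank_transpose, rank_consRow_of_notMem, rank_transpose]
  · rwa [hA.eq]
  · rintro ⟨u, hu⟩
    rw [vecMul_consRow_transpose, Fin.cons_inj] at hu
    exact hv ⟨u, hu.2⟩

/-- A symmetric matrix of order `m + 1` is a symmetric matrix of order `m` with a border. -/
def borderEquiv (F : Type*) [Field F] (m : ℕ) :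
    symMatrices F m × ((Fin m → F) × F) ≃ symMatrices F (m + 1) where
  toFun p := ⟨border p.1.1 p.2.1 p.2.2, isSymm_border p.1.2 _ _⟩
  invFun M := (⟨M.1.submatrix Fin.succ Fin.succ, IsSymm.submatrix M.2 _⟩,
    (fun j => M.1 0 j.succ, M.1 0 0))
  left_inv _ := rfl
  right_inv M := Subtype.ext (border_self M.2)

/-- The rank of a symmetric matrix with zero diagonal is even in characteristic two. -/
theorem even_rank_of_diag_eq_zero [CharP F 2] :
    ∀ {m : ℕ} {A : Matrix (Fin m) (Fin m) F}, A.IsSymm → (∀ i, A i i = 0) → Even A.rank := by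
  intro m
  induction m with
  | zero =>
    intro A _ _
    have := A.rank_le_width
    rw [Nat.le_zero.1 this]
    exact Even.zero
  | succ m ih =>
    intro M hM hd
    have hA : (M.submatrix Fin.succ Fin.succ).IsSymm := IsSymm.submatrix hM _
    have hrank := ih hA fun i => hd i.succ
    rw [← border_self hM]
    set A := M.submatrix Fin.succ Fin.succ with hAdef
    rw [hd 0]
    by_cases hv : ∃ w, w ᵥ* A = fun j => M 0 j.succ
    · obtain ⟨w, hw⟩ := hv
      -- The `(i, j)` and `(j, i)` terms cancel in characteristic two and the diagonal terms vanish.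
      -- The corner is therefore the one that keeps the rank, and bordering changes the rank by 0 or
      -- 2 only.
      have h0 : (0 : F) = w ⬝ᵥ (w ᵥ* A) := by
        symm
        have : w ⬝ᵥ (w ᵥ* A) = ∑ p : Fin m × Fin m, w p.2 * (w p.1 * A p.1 p.2) := by
          rw [Fintype.sum_prod_type_right]
          simp [dotProduct, vecMul, Finset.mul_sum]
        rw [this]
        refine Finset.sum_involution (fun p _ => p.swap) ?_ ?_ ?_ ?_
        · rintro ⟨i, j⟩ _
          have hs : A j i = A i j := hA.apply _ _
          simp only [Prod.swap, hs]
          rw [show w j * (w i * A i j) + w i * (w j * A i j) = 2 * (w j * (w i * A i j)) by ring,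
            CharTwo.two_eq_zero, zero_mul]
        · rintro ⟨i, j⟩ _ hne heq
          have hij : i = j := congrArg Prod.snd heq
          apply hne
          have : A j j = 0 := hd j.succ
          simp [hij, this]
        · simp
        · simp
      rw [← hw, h0, rank_border_of_mem_of_eq hA]
      exact hrank
    · rw [rank_border_of_notMem hA hv]
      exact hrank.add even_two

end Border

/-! ### Counting symmetric matrices of bounded rank -/

section Count

variable {F : Type*} [Field F] {m : ℕ}

theorem rank_neg (A : Matrix (Fin m) (Fin m) F) : (-A).rank = A.rank := by
  rw [← neg_one_smul F A, rank_smul_of_mem_nonZeroDivisors _ (by simp)]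

theorem mem_ball_zero {M : symMatrices F m} {t : ℕ} :
    M ∈ ball (0 : symMatrices F m) t ↔ M.1.rank ≤ t := by
  have h : (0 - M.1).rank = M.1.rank := by
    rw [zero_sub, rank_neg]
  rw [zero_sub] at h
  simp [ball, sphere, rankDist, h]

theorem ballSize_eq_card (t : ℕ) :
    ballSize F m t = Nat.card {M : symMatrices F m // M.1.rank ≤ t} := by
  rw [ballSize, ← Nat.card_coe_set_eq]
  exact Nat.card_congr (Equiv.subtypeEquivRight fun M => mem_ball_zero)

theorem card_vecMul_range (A : Matrix (Fin m) (Fin m) F) :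
    Nat.card {v : Fin m → F // ∃ w, w ᵥ* A = v} = Nat.card F ^ A.rank := by
  have h := Module.natCard_eq_pow_finrank (K := F) (V := LinearMap.range Aᵀ.mulVecLin)
  rw [← rank_transpose A, Matrix.rank, ← h]
  refine Nat.card_congr (Equiv.subtypeEquivRight fun v => ?_)
  simp

theorem card_border_of_add_two_le {A : Matrix (Fin m) (Fin m) F} (hA : A.IsSymm) {t : ℕ}
    (h : A.rank + 2 ≤ t) :
    Nat.card {p : (Fin m → F) × F // (border A p.1 p.2).rank ≤ t} = Nat.card F ^ (m + 1) := by
  have hall : ∀ p : (Fin m → F) × F, (border A p.1 p.2).rank ≤ t := by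
    rintro ⟨v, a⟩
    by_cases hv : ∃ w, w ᵥ* A = v
    · obtain ⟨w, rfl⟩ := hv
      by_cases ha : a = w ⬝ᵥ (w ᵥ* A)
      · subst ha
        have := rank_border_of_mem_of_eq hA w
        dsimp only
        omega
      · have := rank_border_of_mem_of_ne hA w ha
        dsimp only
        omega
    · have := rank_border_of_notMem hA hv a
      dsimp only
      omega
  rw [Nat.card_congr (Equiv.subtypeUnivEquiv hall), Nat.card_prod, Nat.card_fun, Nat.card_fin,
    pow_succ]

/-- Ranks `t` and `t - 1` give the same count: at rank `t` each of the `q^t` admissible borders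
forces the corner, at rank `t - 1` each of the `q^(t-1)` borders leaves it free. This coincidence
lets the recursion close on ball sizes alone. -/
theorem card_border_of_le_of_lt {A : Matrix (Fin m) (Fin m) F} (hA : A.IsSymm) {t : ℕ}
    (h : A.rank ≤ t) (h' : t < A.rank + 2) :
    Nat.card {p : (Fin m → F) × F // (border A p.1 p.2).rank ≤ t} = Nat.card F ^ t := by
  have hmem : ∀ p : (Fin m → F) × F, (border A p.1 p.2).rank ≤ t → ∃ w, w ᵥ* A = p.1 := by
    rintro p hp
    by_contra hv
    have := rank_border_of_notMem hA hv p.2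
    omega
  rcases (show A.rank = t ∨ A.rank + 1 = t by omega) with ht | ht
  · rw [← ht, ← card_vecMul_range]
    refine Nat.card_congr (Equiv.ofBijective (fun p => ⟨p.1.1, hmem _ (p.2.trans h)⟩) ⟨?_, ?_⟩)
    · have key : ∀ w a, (border A (w ᵥ* A) a).rank ≤ A.rank → a = w ⬝ᵥ (w ᵥ* A) := by
        intro w a hr
        by_contra hne
        have := rank_border_of_mem_of_ne hA w hne
        omega
      rintro ⟨⟨v, a⟩, hp⟩ ⟨⟨v', a'⟩, hp'⟩ heq
      obtain rfl : v = v' := congrArg Subtype.val heq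
      obtain ⟨w, rfl⟩ := hmem _ (hp.trans h)
      rw [Subtype.mk.injEq, key w a hp, key w a' hp']
    · rintro ⟨_, w, rfl⟩
      exact ⟨⟨(w ᵥ* A, w ⬝ᵥ (w ᵥ* A)), (rank_border_of_mem_of_eq hA w).le⟩, rfl⟩
  · rw [← ht, pow_succ, ← card_vecMul_range, ← Nat.card_prod]
    refine Nat.card_congr
      { toFun := fun p => (⟨p.1.1, hmem _ (p.2.trans ht.le)⟩, p.1.2)
        invFun := fun p => ⟨(p.1.1, p.2), ?_⟩
        left_inv := fun _ => rfl
        right_inv := fun _ => rfl }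
    obtain ⟨⟨_, w, rfl⟩, a⟩ := p
    by_cases ha : a = w ⬝ᵥ (w ᵥ* A)
    · subst ha
      exact (rank_border_of_mem_of_eq hA w).le.trans (Nat.le_succ _)
    · exact (rank_border_of_mem_of_ne hA w ha).le

theorem card_border_of_lt {A : Matrix (Fin m) (Fin m) F} (hA : A.IsSymm) {t : ℕ}
    (h : t < A.rank) : Nat.card {p : (Fin m → F) × F // (border A p.1 p.2).rank ≤ t} = 0 := by
  have : IsEmpty {p : (Fin m → F) × F // (border A p.1 p.2).rank ≤ t} := by
    refine ⟨fun ⟨⟨v, a⟩, hp⟩ => ?_⟩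
    dsimp only at hp
    by_cases hv : ∃ w, w ᵥ* A = v
    · obtain ⟨w, rfl⟩ := hv
      by_cases ha : a = w ⬝ᵥ (w ᵥ* A)
      · subst ha
        have := rank_border_of_mem_of_eq hA w
        omega
      · have := rank_border_of_mem_of_ne hA w ha
        omega
    · have := rank_border_of_notMem hA hv a
      omega
  exact Nat.card_of_isEmpty

theorem card_symMatrices_succ :
    Nat.card (symMatrices F (m + 1)) = Nat.card (symMatrices F m) * Nat.card F ^ (m + 1) := by
  rw [← Nat.card_congr (borderEquiv F m), Nat.card_prod, Nat.card_prod, Nat.card_fun,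
    Nat.card_fin, pow_succ]

theorem card_symMatrices (F : Type*) [Field F] [Finite F] (m : ℕ) :
    Nat.card (symMatrices F m) = Nat.card F ^ ((m ^ 2 + m) / 2) := by
  induction m with
  | zero =>
    have : Subsingleton (symMatrices F 0) := inferInstance
    simp
  | succ m ih =>
    rw [card_symMatrices_succ, ih, ← pow_add]
    congr 1
    have : (m + 1) ^ 2 + (m + 1) = (m ^ 2 + m) + (m + 1) * 2 := by ring
    rw [this, Nat.add_mul_div_right _ _ two_pos]

theorem ballSize_eq_sum [Fintype (symMatrices F m)] (t : ℕ) :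
    ballSize F m t = ∑ A : symMatrices F m, if A.1.rank ≤ t then 1 else 0 := by
  rw [ballSize_eq_card, Nat.card_eq_fintype_card, Fintype.card_subtype, Finset.card_filter]

variable [Finite F]

instance : Finite (symMatrices F m) := Subtype.finite

theorem ballSize_succ_eq_sum [Fintype (symMatrices F m)] (t : ℕ) :
    ballSize F (m + 1) t = ∑ A : symMatrices F m,
      Nat.card {p : (Fin m → F) × F // (border A.1 p.1 p.2).rank ≤ t} := by
  rw [← Nat.card_sigma, ballSize_eq_card]
  exact Nat.card_congr
    (((borderEquiv F m).subtypeEquiv fun _ => Iff.rfl).symm.trans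
      (Equiv.subtypeProdEquivSigmaSubtype
        fun (A : symMatrices F m) (p : (Fin m → F) × F) => (border A.1 p.1 p.2).rank ≤ t))

theorem ballSize_succ_of_lt_two {t : ℕ} (ht : t < 2) :
    ballSize F (m + 1) t = Nat.card F ^ t * ballSize F m t := by
  have := Fintype.ofFinite (symMatrices F m)
  rw [ballSize_succ_eq_sum, ballSize_eq_sum, Finset.mul_sum]
  refine Finset.sum_congr rfl fun A _ => ?_
  split_ifs with h
  · rw [card_border_of_le_of_lt A.2 h (by omega), mul_one]
  · rw [card_border_of_lt A.2 (by omega), mul_zero]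

/-- Each lower right block of rank at most `t` has `q^(m+1)` extensions, one of rank `t + 1` or `t +
2` has `q^(t+2)`. The subtracted term is moved to the left to stay in `ℕ`. -/
theorem ballSize_succ_add_two (t : ℕ) :
    ballSize F (m + 1) (t + 2) + Nat.card F ^ (t + 2) * ballSize F m t =
      Nat.card F ^ (m + 1) * ballSize F m t + Nat.card F ^ (t + 2) * ballSize F m (t + 2) := by
  have := Fintype.ofFinite (symMatrices F m)
  rw [ballSize_succ_eq_sum, ballSize_eq_sum, ballSize_eq_sum, Finset.mul_sum, Finset.mul_sum,
    Finset.mul_sum, ← Finset.sum_add_distrib, ← Finset.sum_add_distrib]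
  refine Finset.sum_congr rfl fun A _ => ?_
  by_cases h : A.1.rank ≤ t
  · rw [card_border_of_add_two_le A.2 (by omega), if_pos h, if_pos (by omega), mul_one, mul_one]
  · rw [if_neg h, mul_zero, mul_zero, add_zero, zero_add]
    split_ifs with h'
    · rw [card_border_of_le_of_lt A.2 h' (by omega), mul_one]
    · rw [card_border_of_lt A.2 (by omega), mul_zero]

theorem ballSize_self (F : Type*) [Field F] [Finite F] (m : ℕ) :
    ballSize F m m = Nat.card F ^ ((m ^ 2 + m) / 2) := by
  rw [ballSize_eq_card, ← card_symMatrices]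
  exact Nat.card_congr (Equiv.subtypeUnivEquiv fun M => M.1.rank_le_width)

theorem ballSize_zero_right (F : Type*) [Field F] [Finite F] (m : ℕ) : ballSize F m 0 = 1 := by
  induction m with
  | zero => simpa using ballSize_self F 0
  | succ m ih => rw [ballSize_succ_of_lt_two two_pos, ih, pow_zero, mul_one]

theorem ballSize_one_right (F : Type*) [Field F] [Finite F] {m : ℕ} (hm : m ≠ 0) :
    ballSize F m 1 = Nat.card F ^ m := by
  induction m with
  | zero => exact absurd rfl hm
  | succ m ih =>
    rcases eq_or_ne m 0 with rfl | h
    · simpa using ballSize_self F 1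
    · rw [ballSize_succ_of_lt_two one_lt_two, ih h, pow_one, pow_succ']

end Count

/-! ### The normalized ball size -/

section Ratio

variable (F : Type*) [Field F]

/-- The size of the ball of radius `t` in `Sym_q(t + k)`, divided by its power of `q` of the
expected exponent. -/
noncomputable def ballRatio (t k : ℕ) : ℝ :=
  ballSize F (t + k) t / (Nat.card F : ℝ) ^ ((t ^ 2 + t) / 2 + t * k)

theorem ballRatio_nonneg (t k : ℕ) : 0 ≤ ballRatio F t k := by
  unfold ballRatio
  positivity

variable [Finite F]

theorem two_le_card : (2 : ℝ) ≤ Nat.card F := by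
  exact_mod_cast Finite.one_lt_card (α := F)

theorem ballSize_eq_ballRatio_mul (t k : ℕ) :
    (ballSize F (t + k) t : ℝ) =
      ballRatio F t k * (Nat.card F : ℝ) ^ ((t ^ 2 + t) / 2 + t * k) := by
  have := two_le_card F
  rw [ballRatio, div_mul_cancel₀ _ (by positivity)]

theorem ballRatio_zero_right (t : ℕ) : ballRatio F t 0 = 1 := by
  have := two_le_card F
  rw [ballRatio, add_zero, ballSize_self, mul_zero, add_zero, Nat.cast_pow,
    div_self (by positivity)]

theorem ballRatio_zero_left (k : ℕ) : ballRatio F 0 k = 1 := by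
  simp [ballRatio, ballSize_zero_right]

theorem ballRatio_one_left (k : ℕ) : ballRatio F 1 k = 1 := by
  have := two_le_card F
  rw [ballRatio, ballSize_one_right F (by omega)]
  norm_num

/-- In normalized form the recursion has positive increments that decay geometrically in `k`, which
yields both monotonicity and boundedness. -/
theorem ballRatio_add_two_succ (s k : ℕ) :
    ballRatio F (s + 2) (k + 1) = ballRatio F (s + 2) k +
      ballRatio F s (k + 2) *
        ((Nat.card F : ℝ)⁻¹ ^ (k + 2) * (1 - (Nat.card F : ℝ)⁻¹ ^ (k + 1))) := by
  have hq := two_le_card F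
  have h := ballSize_succ_add_two (F := F) (m := s + (k + 2)) s
  have h1 := ballSize_eq_ballRatio_mul F s (k + 2)
  have h2 := ballSize_eq_ballRatio_mul F (s + 2) k
  have h3 := ballSize_eq_ballRatio_mul F (s + 2) (k + 1)
  have he : ((s + 2) ^ 2 + (s + 2)) / 2 = (s ^ 2 + s) / 2 + (2 * s + 3) := by
    rw [show (s + 2) ^ 2 + (s + 2) = (s ^ 2 + s) + (2 * s + 3) * 2 by ring,
      Nat.add_mul_div_right _ _ two_pos]
  set e := (s ^ 2 + s) / 2
  rw [he] at h2 h3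
  rw [show s + (k + 2) + 1 = s + 2 + (k + 1) by ring] at h
  rw [show s + (k + 2) = s + 2 + k by omega] at h h1
  have h' : (ballSize F (s + 2 + (k + 1)) (s + 2) : ℝ) +
      (Nat.card F : ℝ) ^ (s + 2) * ballSize F (s + 2 + k) s =
      (Nat.card F : ℝ) ^ (s + 2 + (k + 1)) * ballSize F (s + 2 + k) s +
      (Nat.card F : ℝ) ^ (s + 2) * ballSize F (s + 2 + k) (s + 2) := by exact_mod_cast h
  rw [h1, h2, h3] at h'
  set q : ℝ := (Nat.card F : ℝ)
  have hq0 : q ≠ 0 := by positivity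
  have hE : q ^ (e + (2 * s + 3) + (s + 2) * (k + 1)) ≠ 0 := by positivity
  refine mul_right_cancel₀ hE ?_
  rw [eq_sub_of_add_eq h', add_mul _ _ (q ^ _)]
  have i1 : q⁻¹ ^ (k + 2) * (1 - q⁻¹ ^ (k + 1)) * q ^ (e + (2 * s + 3) + (s + 2) * (k + 1)) =
      q ^ (s + 2 + (k + 1)) * q ^ (e + s * (k + 2)) - q ^ (s + 2) * q ^ (e + s * (k + 2)) := by
    rw [show e + (2 * s + 3) + (s + 2) * (k + 1) =
      (s + 2) + (e + s * (k + 2)) + (k + 1) + (k + 2) by ring]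
    simp only [pow_add _ _ (k + 2), pow_add _ _ (k + 1), inv_pow]
    field_simp
    ring
  rw [mul_assoc (ballRatio F s (k + 2)), i1]
  ring

theorem ballRatio_le_succ (s k : ℕ) :
    ballRatio F (s + 2) k ≤ ballRatio F (s + 2) (k + 1) := by
  have hq := two_le_card F
  rw [ballRatio_add_two_succ]
  have h1 : (Nat.card F : ℝ)⁻¹ ^ (k + 1) ≤ 1 :=
    pow_le_one₀ (by positivity) (inv_le_one_of_one_le₀ (by linarith))
  have h2 := ballRatio_nonneg F s (k + 2)
  have h3 : 0 ≤ 1 - (Nat.card F : ℝ)⁻¹ ^ (k + 1) := by linarith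
  have : 0 ≤ ballRatio F s (k + 2) *
        ((Nat.card F : ℝ)⁻¹ ^ (k + 2) * (1 - (Nat.card F : ℝ)⁻¹ ^ (k + 1))) := by positivity
  linarith

theorem one_le_ballRatio (t k : ℕ) : 1 ≤ ballRatio F t k := by
  match t with
  | 0 => rw [ballRatio_zero_left]
  | 1 => rw [ballRatio_one_left]
  | s + 2 =>
    rw [← ballRatio_zero_right F (s + 2)]
    exact monotone_nat_of_le_succ (ballRatio_le_succ F s) (Nat.zero_le k)

theorem one_lt_ballRatio_one (s : ℕ) : 1 < ballRatio F (s + 2) 1 := by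
  have hq := two_le_card F
  rw [← zero_add 1, ballRatio_add_two_succ, ballRatio_zero_right]
  have h2 := one_le_ballRatio F s 2
  have h3 : (Nat.card F : ℝ)⁻¹ < 1 := inv_lt_one_of_one_lt₀ (by linarith)
  have h4 : 0 < 1 - (Nat.card F : ℝ)⁻¹ := by linarith
  have : 0 < ballRatio F s (0 + 2) *
        ((Nat.card F : ℝ)⁻¹ ^ (0 + 2) * (1 - (Nat.card F : ℝ)⁻¹ ^ (0 + 1))) := by
    rw [zero_add, zero_add, pow_one]
    positivity
  linarith

/-- The gap below 2 must be uniform in `k`, so that division by `q`, possibly equal to 2, leaves a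
gap below 1. -/
theorem exists_ballRatio_le (t : ℕ) : ∃ δ : ℝ, 0 < δ ∧ ∀ k, ballRatio F t k ≤ 2 - δ := by
  have hq := two_le_card F
  induction t using Nat.twoStepInduction with
  | zero => exact ⟨1, one_pos, fun k => by rw [ballRatio_zero_left]; norm_num⟩
  | one => exact ⟨1, one_pos, fun k => by rw [ballRatio_one_left]; norm_num⟩
  | more s ih _ =>
    obtain ⟨δ, hδ, h⟩ := ih
    have hδ2 : 0 ≤ 2 - δ := (ballRatio_nonneg F s 0).trans (h 0)
    refine ⟨δ / 2, by positivity, fun k => ?_⟩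
    -- The right side is 1 plus the sum of `(2 - δ) * (1 / 2) ^ (j + 2)` over `j < k`, the bound on
    -- the increments when `q ≥ 2`. It stays below `1 + (2 - δ) / 2 = 2 - δ / 2`.
    have key : ∀ k, ballRatio F (s + 2) k ≤ 1 + (2 - δ) * (1 / 2) * (1 - (1 / 2) ^ k) := by
      intro k
      induction k with
      | zero => rw [ballRatio_zero_right]; simp
      | succ k ih =>
        rw [ballRatio_add_two_succ]
        have h1 : (Nat.card F : ℝ)⁻¹ ≤ 1 / 2 := by
          rw [one_div]
          exact inv_anti₀ two_pos hq
        have h2 : (Nat.card F : ℝ)⁻¹ ^ (k + 2) ≤ (1 / 2) ^ (k + 2) :=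
          pow_le_pow_left₀ (by positivity) h1 _
        have h3 : (0 : ℝ) ≤ (Nat.card F : ℝ)⁻¹ ^ (k + 1) := by positivity
        have h4 : (Nat.card F : ℝ)⁻¹ ^ (k + 2) * (1 - (Nat.card F : ℝ)⁻¹ ^ (k + 1)) ≤
            (1 / 2) ^ (k + 2) := by
          refine le_trans (mul_le_of_le_one_right (by positivity) (by linarith)) h2
        have h5 := mul_le_mul (h (k + 2)) le_rfl (by positivity : (0 : ℝ) ≤ (1 / 2) ^ (k + 2))
          hδ2
        have h6 := mul_le_mul_of_nonneg_left h4 (ballRatio_nonneg F s (k + 2))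
        have h7 : (2 - δ) * (1 / 2) * (1 - (1 / 2) ^ k) + (2 - δ) * (1 / 2) ^ (k + 2) =
            (2 - δ) * (1 / 2) * (1 - (1 / 2) ^ (k + 1)) := by ring
        linarith
    have h8 : (0 : ℝ) ≤ (1 / 2) ^ k := by positivity
    nlinarith [key k, mul_nonneg hδ2 h8]

/-- The product of a power of `q` and a ball size stays away from `1` when normalized by a
power of `q`, if the radius is at least two. -/
theorem exists_le_abs_pow_mul_ballSize_sub_one (s : ℕ) : ∃ ε : ℝ, 0 < ε ∧ ∀ k n N : ℕ,
    ε ≤ |(Nat.card F : ℝ) ^ n * ballSize F (s + 2 + (k + 1)) (s + 2) /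
      (Nat.card F : ℝ) ^ N - 1| := by
  have hq := two_le_card F
  obtain ⟨δ, hδ, h⟩ := exists_ballRatio_le F (s + 2)
  have h1 := one_lt_ballRatio_one F s
  -- A nonnegative power of `q` keeps the value at or above `ballRatio F (s + 2) 1`; a negative one
  -- brings it to at most `(2 - δ) / 2 = 1 - δ / 2`.
  refine ⟨min (ballRatio F (s + 2) 1 - 1) (δ / 2), lt_min (by linarith) (by linarith),
    fun k n N => ?_⟩
  rw [ballSize_eq_ballRatio_mul]
  set e := ((s + 2) ^ 2 + (s + 2)) / 2 + (s + 2) * (k + 1)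
  have hρ : ballRatio F (s + 2) 1 ≤ ballRatio F (s + 2) (k + 1) :=
    monotone_nat_of_le_succ (ballRatio_le_succ F s) (by omega)
  have hρ' := h (k + 1)
  set ρ := ballRatio F (s + 2) (k + 1)
  rw [show (Nat.card F : ℝ) ^ n * (ρ * (Nat.card F : ℝ) ^ e) = ρ * (Nat.card F : ℝ) ^ (n + e) by
    ring]
  set q : ℝ := (Nat.card F : ℝ)
  rcases le_or_gt N (n + e) with hN | hN
  · refine (min_le_left _ _).trans ?_
    obtain ⟨j, hj⟩ := Nat.exists_eq_add_of_le hN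
    rw [hj, pow_add, mul_div_assoc, mul_div_cancel_left₀ _ (by positivity)]
    have : 1 ≤ q ^ j := one_le_pow₀ (by linarith)
    have : ρ ≤ ρ * q ^ j := le_mul_of_one_le_right (by linarith) this
    exact le_trans (by linarith) (le_abs_self _)
  · refine (min_le_right _ _).trans ?_
    obtain ⟨j, hj⟩ := Nat.exists_eq_add_of_le hN
    rw [hj, show (n + e).succ + j = (n + e) + (j + 1) by omega, pow_add _ (n + e) (j + 1),
      mul_comm ρ, mul_div_mul_left _ _ (by positivity)]
    have h2 : 2 ≤ q ^ (j + 1) := hq.trans (le_self_pow₀ (by linarith) (by omega))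
    have : ρ / q ^ (j + 1) ≤ (2 - δ) / 2 :=
      div_le_div₀ (by linarith) hρ' two_pos h2
    refine le_trans ?_ (neg_le_abs _)
    linarith

end Ratio

/-! ### Codes, sphere packing and perfect codes -/

section Codes

variable {F : Type*} [Field F] {m : ℕ}

theorem rank_add_le (A B : Matrix (Fin m) (Fin m) F) : (A + B).rank ≤ A.rank + B.rank := by
  have h : LinearMap.range (A + B).mulVecLin ≤
      LinearMap.range A.mulVecLin ⊔ LinearMap.range B.mulVecLin := by
    rintro _ ⟨x, rfl⟩
    rw [mulVecLin_add]
    exact Submodule.add_mem_sup ⟨x, rfl⟩ ⟨x, rfl⟩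
  exact (Submodule.finrank_mono h).trans (Submodule.finrank_add_le_finrank_add_finrank _ _)

theorem rank_sub_le (A B : Matrix (Fin m) (Fin m) F) : (A - B).rank ≤ A.rank + B.rank := by
  rw [sub_eq_add_neg, ← rank_neg B]
  exact rank_add_le _ _

theorem rank_eq_zero_iff {A : Matrix (Fin m) (Fin m) F} : A.rank = 0 ↔ A = 0 := by
  refine ⟨fun h => ?_, fun h => by rw [h, rank_zero]⟩
  rw [Matrix.rank, Submodule.finrank_eq_zero, LinearMap.range_eq_bot] at h
  ext i j
  simpa using congrFun (LinearMap.congr_fun h (Pi.single j 1)) i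

theorem exists_symMatrices_rank_eq (F : Type*) [Field F] {m r : ℕ} (h : r ≤ m) :
    ∃ M : symMatrices F m, M.1.rank = r := by
  classical
  refine ⟨⟨diagonal fun i => if i.1 < r then 1 else 0, isSymm_diagonal _⟩, ?_⟩
  dsimp only
  rw [rank_diagonal]
  simp only [ne_eq, ite_eq_right_iff, one_ne_zero, imp_false, not_not]
  rw [Fintype.card_subtype, Fin.card_filter_val_lt, min_eq_right h]

variable {C : SymCode F m}

theorem minDist_le_rank {A : symMatrices F m} (hA : A ∈ C) (h : A ≠ 0) :
    minDist C ≤ A.1.rank := by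
  refine Nat.sInf_le ⟨A, hA, 0, C.zero_mem, h, ?_⟩
  simp [rankDist]

theorem exists_rank_eq_minDist (hC : C ≠ ⊥) : ∃ A ∈ C, A ≠ 0 ∧ A.1.rank = minDist C := by
  have hne : {r : ℕ | ∃ A ∈ C, ∃ B ∈ C, A ≠ B ∧ rankDist A B = r}.Nonempty := by
    obtain ⟨A, hA, h⟩ := C.ne_bot_iff.1 hC
    exact ⟨_, A, hA, 0, C.zero_mem, h, rfl⟩
  obtain ⟨A, hA, B, hB, hAB, h⟩ := Nat.sInf_mem hne
  exact ⟨A - B, C.sub_mem hA hB, sub_ne_zero.2 hAB, h⟩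

theorem minDist_pos (hC : C ≠ ⊥) : 0 < minDist C := by
  obtain ⟨A, _, h0, h⟩ := exists_rank_eq_minDist hC
  rw [← h, Nat.pos_iff_ne_zero, Ne, rank_eq_zero_iff]
  exact fun h => h0 (Subtype.ext h)

theorem minDist_le_order (hC : C ≠ ⊥) : minDist C ≤ m := by
  obtain ⟨A, _, _, h⟩ := exists_rank_eq_minDist hC
  exact h ▸ A.1.rank_le_width

theorem eq_zero_of_rank_lt_minDist {A : symMatrices F m} (hA : A ∈ C)
    (h : A.1.rank < minDist C) : A = 0 := by
  by_contra h0
  exact absurd (minDist_le_rank hA h0) (not_le.2 h)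

theorem not_isQuasiPerfect_zero (C : CodeFamily F 0) : ¬ C.IsQuasiPerfect :=
  fun _ => (minDist_pos (C.code_ne_bot 0)).ne' (C.minDist_code 0)

theorem injective_add_of_three_le_minDist (hC : 3 ≤ minDist C) :
    Function.Injective fun p : C × {N : symMatrices F m // N.1.rank ≤ 1} => p.1.1 + p.2.1 := by
  rintro ⟨⟨c, hc⟩, N, hN⟩ ⟨⟨c', hc'⟩, N', hN'⟩ heq
  dsimp only at heq
  have hd : c - c' = N' - N := by
    rw [sub_eq_sub_iff_add_eq_add, heq, add_comm]
  have h0 : c - c' = 0 := by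
    refine eq_zero_of_rank_lt_minDist (C.sub_mem hc hc') ?_
    rw [hd]
    have := rank_sub_le N'.1 N.1
    rw [Submodule.coe_sub]
    omega
  obtain rfl := sub_eq_zero.1 h0
  obtain rfl : N = N' := add_left_cancel heq
  rfl

theorem card_code (C : SymCode F m) : Nat.card C = Nat.card F ^ Module.finrank F C :=
  Module.natCard_eq_pow_finrank (K := F) (V := C)

theorem coveringDensity_eq (C : SymCode F m) : coveringDensity C =
    (Nat.card F : ℝ) ^ Module.finrank F C * ballSize F m ((minDist C - 1) / 2) /
      (Nat.card F : ℝ) ^ ((m ^ 2 + m) / 2) := by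
  rw [coveringDensity, card_code, Nat.cast_pow]

variable [Finite F]

theorem finrank_symMatrices (F : Type*) [Field F] [Finite F] (m : ℕ) :
    Module.finrank F (symMatrices F m) = (m ^ 2 + m) / 2 := by
  have h := card_symMatrices F m
  rw [Module.natCard_eq_pow_finrank (K := F)] at h
  exact Nat.pow_right_injective Finite.one_lt_card h

/-- A quotient of powers of `q` within `1 / 2` of `1` is `1`. -/
theorem eq_of_abs_pow_div_pow_sub_one_lt {a b : ℕ}
    (h : |(Nat.card F : ℝ) ^ a / (Nat.card F : ℝ) ^ b - 1| < 1 / 2) : a = b := by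
  have hq := two_le_card F
  set q : ℝ := (Nat.card F : ℝ)
  rw [abs_lt] at h
  rcases lt_trichotomy a b with hab | hab | hab
  · exfalso
    obtain ⟨j, rfl⟩ := Nat.exists_eq_add_of_lt hab
    rw [add_assoc, pow_add, div_mul_cancel_left₀ (by positivity)] at h
    have h2 : 2 ≤ q ^ (j + 1) := hq.trans (le_self_pow₀ (by linarith) (by omega))
    have := inv_anti₀ two_pos h2
    linarith [h.1]
  · exact hab
  · exfalso
    obtain ⟨j, rfl⟩ := Nat.exists_eq_add_of_lt hab
    rw [add_assoc, pow_add, mul_div_cancel_left₀ _ (by positivity)] at h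
    have h2 : 2 ≤ q ^ (j + 1) := hq.trans (le_self_pow₀ (by linarith) (by omega))
    linarith [h.2]

/-- The sphere packing bound for unit balls. -/
theorem finrank_add_le_of_three_le_minDist (hC : 3 ≤ minDist C) (hm : m ≠ 0) :
    Module.finrank F C + m ≤ (m ^ 2 + m) / 2 := by
  have h := Nat.card_le_card_of_injective _ (injective_add_of_three_le_minDist hC)
  rw [Nat.card_prod, card_code, ← ballSize_eq_card, ballSize_one_right F hm, ← pow_add,
    card_symMatrices] at h
  exact (Nat.pow_le_pow_iff_right Finite.one_lt_card).1 h

/-- In a code of minimum distance at least three whose unit balls have total size that of the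
whole space, every symmetric matrix is at distance at most one from a codeword. -/
theorem exists_mem_rank_sub_le_one (hC : 3 ≤ minDist C) (hm : m ≠ 0)
    (h : Module.finrank F C + m = (m ^ 2 + m) / 2) (M : symMatrices F m) :
    ∃ c ∈ C, (M - c).1.rank ≤ 1 := by
  have hcard : Nat.card (C × {N : symMatrices F m // N.1.rank ≤ 1}) =
      Nat.card (symMatrices F m) := by
    rw [Nat.card_prod, card_code, ← ballSize_eq_card, ballSize_one_right F hm, ← pow_add, h,
      card_symMatrices]
  obtain ⟨⟨c, N⟩, rfl⟩ := ((Nat.bijective_iff_injective_and_card _).2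
    ⟨injective_add_of_three_le_minDist hC, hcard⟩).2 M
  exact ⟨c, c.2, by simpa using N.2⟩

/-- A perfect code with unit balls has minimum distance at most three. -/
theorem minDist_le_three (hC : 3 ≤ minDist C) (hm : 2 ≤ m)
    (h : Module.finrank F C + m = (m ^ 2 + m) / 2) : minDist C ≤ 3 := by
  -- A matrix of rank two is too far from `0`, so the codeword within distance one of it is nonzero
  -- and has rank at most `2 + 1`.
  obtain ⟨M, hM⟩ := exists_symMatrices_rank_eq F hm
  obtain ⟨c, hc, hr⟩ := exists_mem_rank_sub_le_one hC (by omega) h M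
  have hc0 : c ≠ 0 := by
    rintro rfl
    rw [sub_zero] at hr
    omega
  have h1 := minDist_le_rank hc hc0
  have h2 := rank_sub_le M.1 (M - c).1
  have h3 : M.1 - (M - c).1 = c.1 := by simp
  rw [h3] at h2
  omega

/-- For unit balls the covering density is a quotient of powers of `q`. -/
theorem coveringDensity_of_radius_one (hm : m ≠ 0) (h : (minDist C - 1) / 2 = 1) :
    coveringDensity C = (Nat.card F : ℝ) ^ (Module.finrank F C + m) /
      (Nat.card F : ℝ) ^ ((m ^ 2 + m) / 2) := by
  rw [coveringDensity_eq, h, ballSize_one_right F hm, Nat.cast_pow, pow_add]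

theorem finrank_add_order_of_isQuasiPerfect {d : ℕ} (hd : (d - 1) / 2 = 1) {C : CodeFamily F d}
    (hC : C.IsQuasiPerfect) : ∀ᶠ i in Filter.atTop,
      Module.finrank F (C.code i) + C.order i = (C.order i ^ 2 + C.order i) / 2 := by
  have h := Metric.tendsto_nhds.1 hC (1 / 2) (by norm_num)
  filter_upwards [h] with i hi
  have h1 := minDist_le_order (C.code_ne_bot i)
  rw [C.minDist_code i] at h1
  rw [coveringDensity_of_radius_one (by omega) (by rwa [C.minDist_code i]), Real.dist_eq] at hi
  exact eq_of_abs_pow_div_pow_sub_one_lt hi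

theorem not_isQuasiPerfect_of_five_le {d : ℕ} (hd : 5 ≤ d) (C : CodeFamily F d) :
    ¬ C.IsQuasiPerfect := by
  intro hC
  obtain ⟨s, hs⟩ : ∃ s, (d - 1) / 2 = s + 2 := ⟨(d - 1) / 2 - 2, by omega⟩
  obtain ⟨ε, hε, h⟩ := exists_le_abs_pow_mul_ballSize_sub_one F s
  obtain ⟨i, hi⟩ := (Metric.tendsto_nhds.1 hC ε hε).exists
  have h1 := minDist_le_order (C.code_ne_bot i)
  rw [C.minDist_code i] at h1
  -- The order is at least `d`, hence larger than the radius. At order equal to the radius the ball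
  -- is the whole space and the normalized size is 1.
  obtain ⟨k, hk⟩ : ∃ k, C.order i = s + 2 + (k + 1) := ⟨C.order i - (s + 3), by omega⟩
  rw [Real.dist_eq, coveringDensity_eq, C.minDist_code, hs] at hi
  have h2 := h k (Module.finrank F (C.code i)) ((C.order i ^ 2 + C.order i) / 2)
  rw [← hk] at h2
  exact absurd hi (not_lt.2 h2)

theorem not_isQuasiPerfect_four (C : CodeFamily F 4) : ¬ C.IsQuasiPerfect := by
  intro hC
  obtain ⟨i, hi⟩ := (finrank_add_order_of_isQuasiPerfect (by norm_num) hC).exists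
  have h1 := minDist_le_order (C.code_ne_bot i)
  have h2 := C.minDist_code i
  have := minDist_le_three (by omega) (by omega) hi
  omega

/-- At radius zero a density near 1 makes the code the whole space, which contains matrices of rank
one. -/
theorem not_isQuasiPerfect_two (C : CodeFamily F 2) : ¬ C.IsQuasiPerfect := by
  intro hC
  obtain ⟨i, hi⟩ := (Metric.tendsto_nhds.1 hC (1 / 2) (by norm_num)).exists
  rw [Real.dist_eq, coveringDensity_eq, C.minDist_code, ballSize_zero_right, Nat.cast_one,
    mul_one] at hi
  have h := eq_of_abs_pow_div_pow_sub_one_lt hi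
  rw [← finrank_symMatrices F] at h
  have htop := Submodule.eq_top_of_finrank_eq h
  have h1 := minDist_le_order (C.code_ne_bot i)
  have h2 := C.minDist_code i
  obtain ⟨M, hM⟩ := exists_symMatrices_rank_eq F (show 1 ≤ C.order i by omega)
  have hM0 : M = 0 :=
    eq_zero_of_rank_lt_minDist (C := C.code i) (htop ▸ Submodule.mem_top) (by omega)
  rw [hM0, Submodule.coe_zero, rank_zero] at hM
  omega

theorem exists_isQuasiPerfect_one (F : Type*) [Field F] [Finite F] :
    ∃ C : CodeFamily F 1, C.IsQuasiPerfect := by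
  obtain ⟨M, hM⟩ := exists_symMatrices_rank_eq F (le_refl 1)
  have hM0 : M ≠ 0 := by
    rintro rfl
    rw [Submodule.coe_zero, rank_zero] at hM
    omega
  have htop : (⊤ : SymCode F 1) ≠ ⊥ := (Submodule.ne_bot_iff _).2 ⟨M, Submodule.mem_top, hM0⟩
  have hd : minDist (⊤ : SymCode F 1) = 1 :=
    le_antisymm (minDist_le_order htop) (minDist_pos htop)
  refine ⟨⟨fun _ => 1, fun _ => ⊤, fun _ => htop, fun _ => hd⟩, ?_⟩
  have hq := two_le_card F
  have h1 : coveringDensity (⊤ : SymCode F 1) = 1 := by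
    rw [coveringDensity_eq, hd, ballSize_zero_right, finrank_top, finrank_symMatrices,
      Nat.cast_one, mul_one, div_self (by positivity)]
  simp only [CodeFamily.IsQuasiPerfect, h1]
  exact tendsto_const_nhds

theorem singletonBound_three {m : ℕ} (hm : Odd m) (h3 : 3 ≤ m) :
    singletonBound m 3 + m = (m ^ 2 + m) / 2 := by
  obtain ⟨k, rfl⟩ := hm
  obtain ⟨k, rfl⟩ : ∃ j, k = j + 1 := ⟨k - 1, by omega⟩
  have : 2 * (k + 1) + 1 - 3 = 2 * k := by omega
  rw [singletonBound, this, if_pos (even_two_mul k),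
    show (2 * (k + 1) + 1) * (2 * k + 2) = (2 * (k + 1) + 1) * (k + 1) * 2 by ring,
    show (2 * (k + 1) + 1) ^ 2 + (2 * (k + 1) + 1) = (2 * (k + 1) + 1) * (k + 2) * 2 by ring,
    Nat.mul_div_cancel _ two_pos, Nat.mul_div_cancel _ two_pos]
  ring

theorem isQuasiPerfect_of_isSymMRD (C : CodeFamily F 3)
    (h : ∀ i, Odd (C.order i) ∧ IsSymMRD (C.code i)) : C.IsQuasiPerfect := by
  have h1 : ∀ i, coveringDensity (C.code i) = 1 := by
    intro i
    have hm := minDist_le_order (C.code_ne_bot i)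
    rw [C.minDist_code i] at hm
    have hq := two_le_card F
    rw [coveringDensity_of_radius_one (by omega) (by rw [C.minDist_code i]), (h i).2.2,
      C.minDist_code i, singletonBound_three (h i).1 hm, div_self (by positivity)]
  simp only [CodeFamily.IsQuasiPerfect, h1]
  exact tendsto_const_nhds

end Codes

/-! ### Existence of symmetric MRD codes with minimum distance three in odd order -/

section Existence

/-- A symmetric matrix of rank `r` is congruent to a symmetric matrix of order `r`. -/
theorem exists_eq_transpose_mul_mul {F : Type*} [Field F] {m r : ℕ}
    {A : Matrix (Fin m) (Fin m) F} (hA : A.IsSymm) (hAr : A.rank = r) :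
    ∃ (V : Matrix (Fin r) (Fin m) F) (S : Matrix (Fin r) (Fin r) F),
      LinearIndependent F V.row ∧ S.IsSymm ∧ A = Vᵀ * S * V := by
  have hr : Module.finrank F (Submodule.span F (Set.range A.row)) = r :=
    (rank_eq_finrank_span_row A).symm.trans hAr
  let b := Module.finBasisOfFinrankEq F (Submodule.span F (Set.range A.row)) hr
  let V : Matrix (Fin r) (Fin m) F := Matrix.of fun k => (b k).1
  let c : Matrix (Fin m) (Fin r) F := Matrix.of fun i =>
    b.repr ⟨A.row i, Submodule.subset_span ⟨i, rfl⟩⟩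
  have hV : LinearIndependent F V.row :=
    b.linearIndependent.map' (Submodule.span F (Set.range A.row)).subtype
      (Submodule.ker_subtype _)
  have hAc : A = c * V := by
    ext i j
    have h := congrArg Subtype.val (b.sum_repr ⟨A.row i, Submodule.subset_span ⟨i, rfl⟩⟩)
    have h' := congrFun h j
    simp only [AddSubmonoidClass.coe_finsetSum, Submodule.coe_smul, Finset.sum_apply,
      Pi.smul_apply, smul_eq_mul] at h'
    rw [mul_apply]
    exact h'.symm
  clear_value c V
  -- The rows of `V` are independent, so `V` has a right inverse `R`. Since `V` spans the row space
  -- of `A`, `A * (R * V) = A`; symmetry gives the transposed identity, and `S = Rᵀ * A * R` works.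
  obtain ⟨R, hR⟩ : ∃ R : Matrix (Fin m) (Fin r) F, V * R = 1 := by
    rw [← mulVec_surjective_iff_exists_right_inverse, ← coe_mulVecLin, ← LinearMap.range_eq_top]
    refine Submodule.eq_top_of_finrank_eq ?_
    rw [Module.finrank_fin_fun]
    exact hV.rank_matrix.trans (Fintype.card_fin _)
  have hR' : Rᵀ * Vᵀ = 1 := by rw [← transpose_mul, hR, transpose_one]
  have hc : c = A * R := by
    rw [hAc, Matrix.mul_assoc, hR, Matrix.mul_one]
  have hAc' : A = Vᵀ * cᵀ := by
    rw [← transpose_mul, ← hAc, hA.eq]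
  refine ⟨V, Rᵀ * A * R, hV, ?_, ?_⟩
  · rw [IsSymm, transpose_mul, transpose_mul, transpose_transpose, hA.eq, Matrix.mul_assoc]
  · have h1 : Vᵀ * (Rᵀ * A * R) * V = Vᵀ * Rᵀ * A * (R * V) := by
      simp only [Matrix.mul_assoc]
    have h2 : A * (R * V) = A := by
      rw [← Matrix.mul_assoc, ← hc, ← hAc]
    have h3 : Vᵀ * Rᵀ * A = A := by
      rw [hAc', show Vᵀ * Rᵀ * (Vᵀ * cᵀ) = Vᵀ * (Rᵀ * Vᵀ) * cᵀ by
        simp only [Matrix.mul_assoc], hR', Matrix.mul_one]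
    rw [h1, h3, h2]

variable {F L : Type*} [Field F] [Field L] [Algebra F L]

/-- If `σ` has no fixed points or points of period two outside `F`, then `z (σ z)`,
`z + σ z` and `1` are linearly independent over `F` for `z` outside `F`. -/
theorem coeff_eq_zero_of_form_eq_zero {σ : L →ₐ[F] L}
    (hσ : ∀ z, σ (σ z) = z → ∃ c, algebraMap F L c = z) {z : L}
    (hz : ¬ ∃ c, algebraMap F L c = z) {a b c : F}
    (h : a • (z * σ z) + b • (z + σ z) + algebraMap F L c = 0) : a = 0 ∧ b = 0 ∧ c = 0 := by
  have h' := congrArg σ h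
  simp only [map_add, map_smul, map_mul, AlgHom.commutes, map_zero] at h'
  -- Subtracting from the relation its image under `σ` removes `c`, and the difference factors.
  have h2 : (algebraMap F L a * σ z + algebraMap F L b) * (z - σ (σ z)) = 0 := by
    simp only [Algebra.smul_def] at h h'
    linear_combination h - h'
  have hne : z - σ (σ z) ≠ 0 := fun h0 => hz (hσ z (sub_eq_zero.1 h0).symm)
  have h3 := (mul_eq_zero.1 h2).resolve_right hne
  have ha : a = 0 := by
    by_contra ha
    have hw : σ z = algebraMap F L (-b / a) := by
      have ha' : algebraMap F L a ≠ 0 := (map_ne_zero _).2 ha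
      rw [map_div₀, map_neg, eq_div_iff ha']
      linear_combination h3
    rw [← σ.commutes] at hw
    exact hz ⟨_, (σ.injective hw).symm⟩
  subst ha
  have hb : b = 0 := by simpa using h3
  subst hb
  exact ⟨rfl, rfl, by simpa using h⟩

theorem binary_coeff_eq_zero {σ : L →ₐ[F] L}
    (hσ : ∀ z, σ (σ z) = z → ∃ c, algebraMap F L c = z) {x : Fin 2 → L}
    (hx : LinearIndependent F x) {a b c : F}
    (h : a • (x 0 * σ (x 0)) + b • (x 0 * σ (x 1)) + b • (x 1 * σ (x 0)) +
      c • (x 1 * σ (x 1)) = 0) : a = 0 ∧ b = 0 ∧ c = 0 := by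
  have hx1 : x 1 ≠ 0 := hx.ne_zero 1
  have hz : ¬ ∃ c, algebraMap F L c = x 0 / x 1 := by
    rintro ⟨k, hk⟩
    rw [eq_div_iff hx1, ← Algebra.smul_def] at hk
    have := (LinearIndependent.pair_iff.1
      (show LinearIndependent F ![x 0, x 1] by convert hx; ext i; fin_cases i <;> rfl)) 1 (-k)
      (by rw [one_smul, neg_smul, hk, add_neg_cancel])
    exact one_ne_zero this.1
  -- Dividing by `x 1 * σ (x 1)` turns the binary form into the one in `z = x 0 / x 1`, which lies
  -- outside `F` by independence.
  refine coeff_eq_zero_of_form_eq_zero hσ hz ?_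
  have hσ1 : σ (x 1) ≠ 0 := (map_ne_zero_iff _ σ.injective).2 hx1
  rw [map_div₀]
  simp only [Algebra.smul_def] at h ⊢
  field_simp
  linear_combination h

/-- The linear map sending the symmetric tensor `A` to its image under `x ⊗ y ↦ x * σ y`. -/
noncomputable def twistedForm (σ : L →ₐ[F] L) {m : ℕ} (b : Fin m → L) :
    Matrix (Fin m) (Fin m) F →ₗ[F] L where
  toFun A := ∑ i, ∑ j, A i j • (b i * σ (b j))
  map_add' A B := by simp [add_smul, Finset.sum_add_distrib]
  map_smul' c A := by simp [mul_smul, Finset.smul_sum]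

theorem twistedForm_congr (σ : L →ₐ[F] L) {m r : ℕ} (b : Fin m → L)
    (V : Matrix (Fin r) (Fin m) F) (S : Matrix (Fin r) (Fin r) F) :
    twistedForm σ b (Vᵀ * S * V) = twistedForm σ (fun k => ∑ i, V k i • b i) S := by
  simp only [twistedForm, LinearMap.coe_mk, AddHom.coe_mk, mul_apply, transpose_apply,
    map_sum, map_smul, Finset.sum_mul, Finset.mul_sum, Finset.sum_smul, Finset.smul_sum,
    smul_mul_smul_comm, smul_smul]
  have e1 : ∀ f : Fin m → Fin m → Fin r → Fin r → L, ∑ i, ∑ j, ∑ l, ∑ k, f i j l k =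
      ∑ k, ∑ l, ∑ j, ∑ i, f i j l k := by
    intro f
    rw [Finset.sum_comm]
    simp_rw [Finset.sum_comm (s := (Finset.univ : Finset (Fin m)))
      (t := (Finset.univ : Finset (Fin r)))]
    rw [Finset.sum_comm]
  rw [e1]
  refine Finset.sum_congr rfl fun k _ => Finset.sum_congr rfl fun l _ =>
    Finset.sum_congr rfl fun j _ => Finset.sum_congr rfl fun i _ => ?_
  congr 1
  ring

/-- By `exists_eq_transpose_mul_mul` and `twistedForm_congr`, a matrix of rank `r ≤ 2` becomes a
form in `r` independent elements of `L`; such a form vanishes only with all its coefficients. -/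
theorem three_le_rank_of_twistedForm_eq_zero {σ : L →ₐ[F] L}
    (hσ : ∀ z, σ (σ z) = z → ∃ c, algebraMap F L c = z) {m : ℕ} {b : Fin m → L}
    (hb : LinearIndependent F b) {A : Matrix (Fin m) (Fin m) F} (hA : A.IsSymm) (hA0 : A ≠ 0)
    (h : twistedForm σ b A = 0) : 3 ≤ A.rank := by
  by_contra hlt
  obtain ⟨r, hAr⟩ : ∃ r, A.rank = r := ⟨_, rfl⟩
  have hr : r < 3 := hAr ▸ Nat.lt_of_not_le hlt
  obtain ⟨V, S, hV, hS, hAV⟩ := exists_eq_transpose_mul_mul hA hAr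
  have hS0 : S ≠ 0 := by
    rintro rfl
    apply hA0
    rw [hAV, Matrix.mul_zero, Matrix.zero_mul]
  rw [hAV, twistedForm_congr] at h
  have hx : LinearIndependent F fun k => ∑ i, V k i • b i := by
    have := hV.map' (Fintype.linearCombination F b)
      (LinearMap.ker_eq_bot.2 (linearIndependent_iff_injective_fintypeLinearCombination.1 hb))
    exact this
  set x : Fin r → L := fun k => ∑ i, V k i • b i
  clear_value x
  clear hAV hAr hV V
  apply hS0
  interval_cases r
  · ext i
    exact i.elim0
  · have hx0 : x 0 ≠ 0 := hx.ne_zero 0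
    have hσ0 : σ (x 0) ≠ 0 := (map_ne_zero_iff _ σ.injective).2 hx0
    have h0 : S 0 0 = 0 := by
      simpa [twistedForm, hx0, hσ0] using h
    ext i j
    rw [Subsingleton.elim i 0, Subsingleton.elim j 0, h0, Matrix.zero_apply]
  · have h1 : S 1 0 = S 0 1 := hS.apply _ _
    have h' : S 0 0 • (x 0 * σ (x 0)) + S 0 1 • (x 0 * σ (x 1)) + S 0 1 • (x 1 * σ (x 0)) +
      S 1 1 • (x 1 * σ (x 1)) = 0 := by
      rw [← h]
      simp only [twistedForm, LinearMap.coe_mk, AddHom.coe_mk, Fin.sum_univ_two, h1]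
      ring
    obtain ⟨h00, h01, h11⟩ := binary_coeff_eq_zero hσ hx h'
    ext i j
    fin_cases i <;> fin_cases j <;> simp [h00, h01, h11, h1]

/-- The Frobenius map of an extension of finite fields of odd degree has no points of period
two outside the base field. -/
theorem exists_algebraMap_eq_of_frobenius_frobenius [Fintype F] [Finite L]
    (hodd : Odd (Module.finrank F L)) {z : L}
    (hz : FiniteField.frobeniusAlgHom F L (FiniteField.frobeniusAlgHom F L z) = z) :
    ∃ c, algebraMap F L c = z := by
  have := Fintype.ofFinite L
  obtain ⟨k, hk⟩ := hodd
  set q := Fintype.card F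
  have hz2 : (z ^ q) ^ q = z := hz
  have hper : ∀ j, z ^ q ^ (2 * j) = z := by
    intro j
    induction j with
    | zero => simp
    | succ j ih => rw [mul_add, pow_add, pow_mul, ih, mul_one, pow_two, pow_mul, hz2]
  -- Here `z = z ^ q ^ (2 * k + 1)` since `L` has `q ^ (2 * k + 1)` elements, and period two reduces
  -- the exponent to `q`.
  have hzq : z ^ q = z := by
    have h := FiniteField.pow_card z
    rw [Module.card_eq_pow_finrank (K := F), hk, pow_succ, pow_mul, hper k] at h
    exact h
  have hfix : ∀ j, z ^ q ^ j = z := by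
    intro j
    induction j with
    | zero => simp
    | succ j ih => rw [pow_succ, pow_mul, ih, hzq]
  have hmem : z ∈ Set.range (algebraMap F L) := by
    rw [IsGalois.mem_range_algebraMap_iff_fixed]
    intro f
    obtain ⟨j, rfl⟩ := (FiniteField.bijective_frobeniusAlgEquivOfAlgebraic_pow F L).2 f
    have : ∀ i : ℕ, (FiniteField.frobeniusAlgEquivOfAlgebraic F L ^ i) z = z ^ q ^ i := by
      intro i
      rw [AlgEquiv.coe_pow]
      exact congrFun (FiniteField.coe_frobeniusAlgEquivOfAlgebraic_iterate F L i) z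
    rw [this, hfix]
  exact hmem

theorem exists_isSymMRD_three (F : Type*) [Field F] [Finite F] {m : ℕ} (hm : Odd m)
    (h3 : 3 ≤ m) : ∃ C : SymCode F m, IsSymMRD C ∧ minDist C = 3 := by
  have := Fintype.ofFinite F
  obtain ⟨p, hp⟩ := CharP.exists F
  have hprime : Fact p.Prime := ⟨CharP.char_is_prime F p⟩
  have : NeZero m := ⟨by omega⟩
  let L := FiniteField.Extension F p m
  have hL : Module.finrank F L = m := FiniteField.finrank_extension F p m
  have : Finite L := Module.finite_of_finite F
  let b := Module.finBasisOfFinrankEq F L hL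
  let Φ : symMatrices F m →ₗ[F] L :=
    (twistedForm (FiniteField.frobeniusAlgHom F L) b).comp (symMatrices F m).subtype
  have hrank : ∀ A ∈ LinearMap.ker Φ, A ≠ 0 → 3 ≤ A.1.rank := by
    intro A hA h0
    refine three_le_rank_of_twistedForm_eq_zero
      (fun z => exists_algebraMap_eq_of_frobenius_frobenius (hL.symm ▸ hm)) b.linearIndependent A.2
      (fun h => h0 (Subtype.ext h)) hA
  -- Rank-nullity gives this half, as `L` has dimension `m`. Sphere packing gives the other half, so
  -- the kernel is perfect and its distance is exactly 3.
  have hdim : (m ^ 2 + m) / 2 ≤ Module.finrank F (LinearMap.ker Φ) + m := by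
    have h1 := LinearMap.finrank_range_add_finrank_ker Φ
    have h2 := Submodule.finrank_le (LinearMap.range Φ)
    rw [finrank_symMatrices] at h1
    omega
  have hne : LinearMap.ker Φ ≠ ⊥ := by
    intro h
    rw [h, finrank_bot, zero_add] at hdim
    have : m * 4 ≤ m ^ 2 + m := by nlinarith
    omega
  obtain ⟨A, hA, hA0, hAr⟩ := exists_rank_eq_minDist hne
  have hd : 3 ≤ minDist (LinearMap.ker Φ) := hAr ▸ hrank A hA hA0
  have hdim' : Module.finrank F (LinearMap.ker Φ) + m = (m ^ 2 + m) / 2 :=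
    le_antisymm (finrank_add_le_of_three_le_minDist hd (by omega)) hdim
  have hd3 : minDist (LinearMap.ker Φ) = 3 :=
    le_antisymm (minDist_le_three hd (by omega) hdim') hd
  refine ⟨LinearMap.ker Φ, ⟨hne, ?_⟩, hd3⟩
  have := singletonBound_three hm h3
  rw [hd3]
  omega

theorem exists_isQuasiPerfect_three (F : Type*) [Field F] [Finite F] :
    ∃ C : CodeFamily F 3, C.IsQuasiPerfect := by
  have h3 : Odd 3 := by decide
  obtain ⟨C, hC, hd⟩ := exists_isSymMRD_three F h3 le_rfl
  exact ⟨⟨fun _ => 3, fun _ => C, fun _ => hC.1, fun _ => hd⟩,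
    isQuasiPerfect_of_isSymMRD _ fun _ => ⟨h3, hC⟩⟩

end Existence

/-! ### Quadratic forms in an even number of variables in odd characteristic -/

section Fibres

theorem card_eq_sum_card_fibre {X F : Type*} [Finite X] [Fintype F] (Q : X → F) :
    Nat.card X = ∑ c, Nat.card {x // Q x = c} := by
  rw [← Nat.card_sigma]
  exact Nat.card_congr (Equiv.sigmaFiberEquiv Q).symm

variable {F : Type*} [Field F]

/-- All fibres of a nonzero linear functional have the same size. -/
theorem card_fibre_mul_card [Finite F] {V : Type*} [AddCommGroup V] [Module F V] [Finite V]
    {u : V →ₗ[F] F} (hu : u ≠ 0) (c : F) : Nat.card {x // u x = c} * Nat.card F = Nat.card V := by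
  have := Fintype.ofFinite F
  obtain ⟨v, hv⟩ := LinearMap.surjective hu 1
  have h : ∀ b, Nat.card {x // u x = b} = Nat.card {x // u x = c} := by
    intro b
    refine Nat.card_congr ((Equiv.addRight ((c - b) • v)).subtypeEquiv fun x => ?_)
    simp only [Equiv.coe_addRight, map_add, map_smul, hv, smul_eq_mul, mul_one]
    exact ⟨fun h => by rw [h]; ring, fun h => by linear_combination h⟩
  rw [card_eq_sum_card_fibre u, Finset.sum_congr rfl fun b _ => h b, Finset.sum_const,
    Finset.card_univ, smul_eq_mul, Nat.card_eq_fintype_card (α := F), mul_comm]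

open Classical in
/-- A function to `F` takes each nonzero value equally often, and zero with another frequency. -/
def HasZeroDefect {X : Type*} (Q : X → F) : Prop :=
  ∃ α κ : ℤ, κ ≠ 0 ∧ ∀ c, (Nat.card {x // Q x = c} : ℤ) = α + if c = 0 then κ else 0

theorem HasZeroDefect.comp_equiv {X Y : Type*} {Q : X → F} (hQ : HasZeroDefect Q) (e : Y ≃ X) :
    HasZeroDefect (Q ∘ e) := by
  obtain ⟨α, κ, hκ, h⟩ := hQ
  refine ⟨α, κ, hκ, fun c => ?_⟩
  rw [← h c]
  exact congrArg _ (Nat.card_congr (e.subtypeEquiv fun _ => Iff.rfl))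

variable [Finite F]

/-- Fibre counts convolve. Each is a constant plus a multiple of the indicator of zero; the
indicators convolve to an indicator with coefficient `κ * μ`, and all other terms are constant. -/
theorem HasZeroDefect.add {X Y : Type*} [Finite X] [Finite Y] {Q : X → F} {R : Y → F}
    (hQ : HasZeroDefect Q) (hR : HasZeroDefect R) :
    HasZeroDefect fun p : X × Y => Q p.1 + R p.2 := by
  classical
  have := Fintype.ofFinite F
  obtain ⟨α, κ, hκ, h⟩ := hQ
  obtain ⟨β, μ, hμ, h'⟩ := hR
  refine ⟨Nat.card F * α * β + κ * β + α * μ, κ * μ, mul_ne_zero hκ hμ, fun c => ?_⟩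
  have e : {p : X × Y // Q p.1 + R p.2 = c} ≃ Σ s, {x // Q x = s} × {y // R y = c - s} :=
    { toFun := fun p => ⟨Q p.1.1, ⟨p.1.1, rfl⟩, ⟨p.1.2, eq_sub_of_add_eq' p.2⟩⟩
      invFun := fun p => ⟨(p.2.1.1, p.2.2.1), by rw [p.2.1.2, p.2.2.2]; ring⟩
      left_inv := fun _ => rfl
      right_inv := by
        rintro ⟨_, ⟨x, rfl⟩, y⟩
        rfl }
  rw [Nat.card_congr e, Nat.card_sigma, Nat.cast_sum]
  simp only [Nat.card_prod, Nat.cast_mul, h, h', sub_eq_zero]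
  simp only [add_mul, mul_add, Finset.sum_add_distrib, Finset.sum_const, Finset.card_univ,
    mul_ite, ite_mul, mul_zero, zero_mul, Finset.sum_ite_eq, Finset.sum_ite_eq', Finset.mem_univ,
    if_true, Nat.card_eq_fintype_card, nsmul_eq_mul]
  ring

theorem HasZeroDefect.card_ne {X : Type*} [Finite X] {Q : X → F} (hQ : HasZeroDefect Q) :
    Nat.card {x // Q x = 0} * Nat.card F ≠ Nat.card X := by
  classical
  have := Fintype.ofFinite F
  obtain ⟨α, κ, hκ, h⟩ := hQ
  intro heq
  have h1 : (Nat.card X : ℤ) = Nat.card F * α + κ := by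
    rw [card_eq_sum_card_fibre Q, Nat.cast_sum, Finset.sum_congr rfl fun c _ => h c]
    simp [Finset.sum_add_distrib]
  rw [← heq, Nat.cast_mul, h 0, if_pos rfl] at h1
  have h2 : (1 : ℤ) < Nat.card F := by exact_mod_cast Finite.one_lt_card (α := F)
  have h3 : ((Nat.card F : ℤ) - 1) * κ = 0 := by linear_combination h1
  rcases mul_eq_zero.1 h3 with h4 | h4
  · omega
  · exact hκ h4

end Fibres

/-! ### Zeros of nondegenerate quadratic forms in even dimension, odd characteristic -/

section OddCharacteristic

variable {F : Type*} [Field F] [Finite F]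

theorem exists_sq_add_mul_sq_eq (hF : ringChar F ≠ 2) {d : F} (hd : d ≠ 0) (r : F) :
    ∃ s t : F, s ^ 2 + d * t ^ 2 = r := by
  open Polynomial in
  have := Fintype.ofFinite F
  have h1 : degree (X ^ 2 - C r : F[X]) = 2 := degree_X_pow_sub_C two_pos r
  have h2 : degree (C d * X ^ 2 : F[X]) = 2 := degree_C_mul_X_pow 2 hd
  obtain ⟨s, t, h⟩ := FiniteField.exists_root_sum_quadratic h1 h2
    (FiniteField.odd_card_of_char_ne_two hF)
  refine ⟨s, t, ?_⟩
  simp only [eval_sub, eval_pow, eval_X, eval_C, eval_mul] at h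
  linear_combination h

theorem hasZeroDefect_binary (hF : ringChar F ≠ 2) {a b : F} (ha : a ≠ 0) (hb : b ≠ 0) :
    HasZeroDefect fun p : F × F => a * (p.1 * p.1) + b * (p.2 * p.2) := by
  classical
  have := Fintype.ofFinite F
  obtain ⟨d, rfl⟩ : ∃ d, b = a * d := ⟨b / a, by field_simp⟩
  have hd : d ≠ 0 := right_ne_zero_of_mul hb
  set Q : F × F → F := fun p => a * (p.1 * p.1) + a * d * (p.2 * p.2) with hQdef
  -- Up to the factor `a`, `Q` is the norm form `x ^ 2 + d * y ^ 2`. Multiplication by `s + t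
  -- √(-d)`, of norm `r ≠ 0`, is injective and scales the values of `Q` by `r`.
  have hle : ∀ c r : F, r ≠ 0 → Nat.card {p // Q p = c} ≤ Nat.card {p // Q p = r * c} := by
    intro c r hr
    obtain ⟨s, t, hst⟩ := exists_sq_add_mul_sq_eq hF hd r
    refine Nat.card_le_card_of_injective
      (fun p => ⟨(s * p.1.1 - d * t * p.1.2, t * p.1.1 + s * p.1.2), ?_⟩) ?_
    · have hp := p.2
      simp only [hQdef] at hp ⊢
      rw [← hst]
      linear_combination (s ^ 2 + d * t ^ 2) * hp
    · rintro ⟨⟨x, y⟩, hp⟩ ⟨⟨x', y'⟩, hp'⟩ heq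
      simp only [Subtype.mk.injEq, Prod.mk.injEq] at heq ⊢
      obtain ⟨h1, h2⟩ := heq
      constructor
      · refine mul_left_cancel₀ hr ?_
        rw [← hst]
        linear_combination s * h1 + d * t * h2
      · refine mul_left_cancel₀ hr ?_
        rw [← hst]
        linear_combination s * h2 - t * h1
  have hconst : ∀ c, c ≠ 0 → Nat.card {p // Q p = c} = Nat.card {p // Q p = 1} := by
    intro c hc
    refine le_antisymm ?_ ?_
    · have := hle c c⁻¹ (inv_ne_zero hc)
      rwa [inv_mul_cancel₀ hc] at this
    · have := hle 1 c hc
      rwa [mul_one] at this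
  have hq := Finite.one_lt_card (α := F)
  refine ⟨Nat.card {p // Q p = 1}, Nat.card {p // Q p = 0} - Nat.card {p // Q p = 1}, ?_, ?_⟩
  · intro h0
    have h1 : Nat.card {p // Q p = 0} = Nat.card {p // Q p = 1} := by omega
    have h2 : Nat.card F * Nat.card F = Nat.card F * Nat.card {p // Q p = 0} := by
      rw [← Nat.card_prod, card_eq_sum_card_fibre Q, Finset.sum_congr rfl
        (g := fun _ => Nat.card {p // Q p = 0}), Finset.sum_const, Finset.card_univ, smul_eq_mul,
        Nat.card_eq_fintype_card (α := F)]
      intro c _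
      by_cases hc : c = 0
      · rw [hc]
      · rw [hconst c hc, h1]
    -- Without a defect there would be exactly `q` zeros. If `-d` is a square the zeros fill two
    -- distinct lines, which is too many; otherwise only the origin is a zero.
    have h3 : Nat.card F = Nat.card {p // Q p = 0} := Nat.eq_of_mul_eq_mul_left (by omega) h2
    have hzero : ∀ x y, Q (x, y) = 0 → x ^ 2 = -d * y ^ 2 := by
      intro x y h
      refine mul_left_cancel₀ ha ?_
      simp only [hQdef] at h
      linear_combination h
    by_cases hz : ∃ z : F, z ^ 2 = -d
    · obtain ⟨z, hz⟩ := hz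
      have hz0 : z ≠ 0 := by
        rintro rfl
        exact hd (by simpa using hz.symm)
      -- The line `x = z * y` supplies `q` zeros and `none` one more, on the line `x = -z * y`.
      have hcard : Nat.card (Option F) ≤ Nat.card {p // Q p = 0} := by
        refine Nat.card_le_card_of_injective (fun o => ⟨o.elim (-z, 1) fun y => (z * y, y), ?_⟩) ?_
        · rcases o with _ | y
          · simp only [hQdef, Option.elim]
            linear_combination a * hz
          · simp only [hQdef, Option.elim]
            linear_combination a * y ^ 2 * hz
        · have h2z : -z ≠ z := fun h => hz0 (by
            have : (2 : F) * z = 0 := by linear_combination -h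
            exact (mul_eq_zero.1 this).resolve_left (Ring.two_ne_zero hF))
          rintro (_ | y) (_ | y') h
          · rfl
          · simp only [Option.elim, Subtype.mk.injEq, Prod.mk.injEq] at h
            rw [← h.2, mul_one] at h
            exact absurd h.1 h2z
          · simp only [Option.elim, Subtype.mk.injEq, Prod.mk.injEq] at h
            rw [h.2, mul_one] at h
            exact absurd h.1.symm h2z
          · simp only [Option.elim, Subtype.mk.injEq, Prod.mk.injEq] at h
            rw [h.2]
      rw [Finite.card_option] at hcard
      omega
    · have hsub : Subsingleton {p // Q p = 0} := by
        have : ∀ p, Q p = 0 → p = 0 := by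
          rintro ⟨x, y⟩ hp
          have h4 := hzero x y hp
          by_cases hy : y = 0
          · subst hy
            have : x = 0 := by simpa using h4
            rw [this]
            rfl
          · exact absurd ⟨x / y, by rw [div_pow, h4]; field_simp⟩ hz
        exact ⟨fun p p' => Subtype.ext ((this _ p.2).trans (this _ p'.2).symm)⟩
      have := Finite.card_le_one_iff_subsingleton.2 hsub
      omega
  · intro c
    split_ifs with hc
    · rw [hc]
      ring
    · rw [hconst c hc, add_zero]

theorem hasZeroDefect_sum_sq (hF : ringChar F ≠ 2) (k : ℕ) (w : Fin (2 * k) → F)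
    (hw : ∀ i, w i ≠ 0) : HasZeroDefect fun x : Fin (2 * k) → F => ∑ i, w i * (x i * x i) := by
  classical
  induction k with
  | zero =>
    refine ⟨0, 1, one_ne_zero, fun c => ?_⟩
    rw [zero_add]
    split_ifs with hc
    · subst hc
      simp
    · have : IsEmpty {x : Fin (2 * 0) → F // ∑ i, w i * (x i * x i) = c} :=
        ⟨fun x => hc (by rw [← x.2]; simp)⟩
      rw [Nat.card_of_isEmpty, Nat.cast_zero]
  | succ k ih =>
    have h := (hasZeroDefect_binary hF (hw 0) (hw 1)).add
      (ih (fun i => w i.succ.succ) fun i => hw _)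
    let e : (Fin (2 * (k + 1)) → F) ≃ (F × F) × (Fin (2 * k) → F) :=
      { toFun := fun x => ((x 0, x 1), fun i => x i.succ.succ)
        invFun := fun p => Fin.cons p.1.1 (Fin.cons p.1.2 p.2 : Fin (2 * k + 1) → F)
        left_inv := fun x => by
          funext i
          refine Fin.cases rfl (fun i => ?_) i
          exact Fin.cases rfl (fun i => rfl) i
        right_inv := fun p => rfl }
    convert h.comp_equiv e using 1
    funext x
    refine (Fin.sum_univ_succ (n := 2 * k + 1) _).trans ?_
    rw [Fin.sum_univ_succ, ← add_assoc]
    rfl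

/-- Diagonalized, the form is an orthogonal sum of binary forms with nonzero defect; defects
multiply, so zero is not taken with the average frequency. -/
theorem card_isotropic_mul_card_ne (hF : ringChar F ≠ 2) {V : Type*} [AddCommGroup V]
    [Module F V] [FiniteDimensional F V] (hV : Even (Module.finrank F V))
    {B : LinearMap.BilinForm F V} (hB : B.IsSymm) (hB' : LinearMap.SeparatingLeft B) :
    Nat.card {x // B x x = 0} * Nat.card F ≠ Nat.card V := by
  have : Invertible (2 : F) := invertibleOfNonzero (Ring.two_ne_zero hF)
  have : Finite V := Module.finite_of_finite F
  obtain ⟨w, ⟨e⟩⟩ := QuadraticForm.equivalent_weightedSumSquares_units_of_nondegenerate'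
    (LinearMap.BilinMap.toQuadraticMap B)
    (by rwa [QuadraticMap.associated_left_inverse F hB.eq])
  obtain ⟨k, hk⟩ := hV.exists_two_nsmul
  have h : HasZeroDefect fun x : Fin (Module.finrank F V) → F =>
      ∑ i, (w i : F) * (x i * x i) := by
    clear e
    revert w
    rw [hk]
    intro w
    exact hasZeroDefect_sum_sq hF k _ fun i => (w i).ne_zero
  have h' : HasZeroDefect fun x : V => B x x := by
    convert h.comp_equiv e.toLinearEquiv.toEquiv using 1
    funext x
    have := e.map_app x
    rw [QuadraticMap.weightedSumSquares_apply] at this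
    exact this.symm
  exact h'.card_ne

end OddCharacteristic

/-! ### Nonexistence of perfect codes with minimum distance three in even order -/

section Products

variable {F V W : Type*} [Field F] [Finite F] [AddCommGroup V] [Module F V]
  [AddCommGroup W] [Module F W]

/-- If the squares of a bilinear product determine the lines of `V`, they are at most as many
as their values up to scalars. -/
theorem card_filter_square_le [Fintype V] [Fintype W] [DecidableEq V] [DecidableEq W]
    (g : V →ₗ[F] V →ₗ[F] W)
    (hg : ∀ x, x ≠ 0 → g x x ≠ 0)
    (hsq : ∀ (a b : F) (x y : V), a ≠ 0 → x ≠ 0 → a • g x x = b • g y y → ∃ s : F, x = s • y)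
    (T : W → Prop) [DecidablePred T] (hT : ∀ a : F, a ≠ 0 → ∀ w, T w → T (a • w)) :
    (Finset.univ.filter fun x : V => x ≠ 0 ∧ T (g x x)).card ≤
      (Finset.univ.filter fun w : W => w ≠ 0 ∧ T w).card := by
  classical
  have := Fintype.ofFinite F
  -- Both sides are counted `q - 1` times through `(a, x) ↦ a • g x x`. Over a given `w` every `x`
  -- is a nonzero multiple `s • y` of one fixed `y`, and `s` determines `x` and then `a`, so fibres
  -- have at most `q - 1` elements.
  have h := Finset.card_le_mul_card_image_of_maps_to
    (f := fun p : Fˣ × V => (p.1 : F) • g p.2 p.2)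
    (s := (Finset.univ : Finset Fˣ) ×ˢ Finset.univ.filter fun x : V => x ≠ 0 ∧ T (g x x))
    (t := Finset.univ.filter fun w : W => w ≠ 0 ∧ T w) ?_ (Fintype.card Fˣ) ?_
  · rw [Finset.card_product, Finset.card_univ] at h
    exact Nat.le_of_mul_le_mul_left h Fintype.card_pos
  · rintro ⟨a, x⟩ hp
    simp only [Finset.mem_product, Finset.mem_univ, Finset.mem_filter, true_and] at hp ⊢
    exact ⟨smul_ne_zero a.ne_zero (hg x hp.1), hT _ a.ne_zero _ hp.2⟩
  · intro w hw
    simp only [Finset.mem_univ, Finset.mem_filter, true_and] at hw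
    rcases Finset.eq_empty_or_nonempty (Finset.filter
      (fun p : Fˣ × V => (p.1 : F) • g p.2 p.2 = w)
      (Finset.univ ×ˢ Finset.univ.filter fun x : V => x ≠ 0 ∧ T (g x x))) with he | ⟨⟨b, y⟩, hb⟩
    · rw [he]
      simp
    · simp only [Finset.mem_product, Finset.mem_univ, Finset.mem_filter, true_and] at hb
      have hs : ∀ p : Fˣ × V, p.2 ≠ 0 → (p.1 : F) • g p.2 p.2 = w →
          ∃ s : Fˣ, p.2 = (s : F) • y := by
        intro p hp hpw
        obtain ⟨s, hs⟩ := hsq p.1 b p.2 y p.1.ne_zero hp (hpw.trans hb.2.symm)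
        have hs0 : s ≠ 0 := by
          rintro rfl
          exact hp (by rw [hs, zero_smul])
        exact ⟨Units.mk0 s hs0, hs⟩
      choose! s hs using hs
      rw [← Finset.card_univ]
      refine Finset.card_le_card_of_injOn s (fun _ _ => Finset.mem_univ _) ?_
      rintro ⟨a, x⟩ hp ⟨a', x'⟩ hp' heq
      simp only [Finset.coe_filter, Finset.mem_product, Finset.mem_univ, Finset.mem_filter,
        true_and, Set.mem_ofPred_eq] at hp hp'
      have hxx : x = x' := by
        have h1 := hs (a, x) hp.1.1 hp.2
        have h2 := hs (a', x') hp'.1.1 hp'.2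
        dsimp only at h1 h2
        rw [h1, h2, heq]
      subst hxx
      have haa : (a : F) = a' := by
        have := hp.2.trans hp'.2.symm
        exact smul_left_injective F (hg x hp.1.1) this
      rw [Units.ext haa]

variable [Finite V] [Finite W]

/-- In odd characteristic, a commutative bilinear product without zero divisors on a space of
positive even dimension has two squares on a common line that come from different lines. -/
theorem exists_smul_square_eq_smul_square (hF : ringChar F ≠ 2)
    (hV : Even (Module.finrank F V)) (hpos : 0 < Module.finrank F V)
    (hVW : Module.finrank F V = Module.finrank F W) (g : V →ₗ[F] V →ₗ[F] W)
    (hsymm : ∀ x y, g x y = g y x) (hg : ∀ x y, g x y = 0 → x ≠ 0 → y = 0) :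
    ∃ (a b : F) (x y : V), a ≠ 0 ∧ x ≠ 0 ∧ a • g x x = b • g y y ∧ ∀ s : F, x ≠ s • y := by
  classical
  by_contra! hcon
  have := Fintype.ofFinite F
  have := Fintype.ofFinite V
  have := Fintype.ofFinite W
  have hg' : ∀ x, x ≠ 0 → g x x ≠ 0 := fun x hx h => hx (hg x x h hx)
  have hcard : Fintype.card V = Fintype.card W := by
    rw [Module.card_eq_pow_finrank (K := F), Module.card_eq_pow_finrank (K := F) (V := W), hVW]
  have : Nontrivial (Module.Dual F W) :=
    Module.nontrivial_of_finrank_pos (R := F) (by rwa [Subspace.dual_finrank_eq, ← hVW])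
  obtain ⟨u, hu⟩ := exists_ne (0 : Module.Dual F W)
  -- The inequality is applied to the kernel of `u` and to its complement. As `V` and `W` have equal
  -- size both are equalities, so `x ↦ u (g x x)` has as many zeros as `u`.
  have h1 := card_filter_square_le g hg' hcon (fun w => u w = 0) fun a _ w hw => by
    rw [map_smul, hw, smul_zero]
  have h2 := card_filter_square_le g hg' hcon (fun w => u w ≠ 0) fun a ha w hw => by
    rw [map_smul]
    exact smul_ne_zero ha hw
  set Z := Finset.univ.filter fun x : V => u (g x x) = 0
  set K := Finset.univ.filter fun w : W => u w = 0
  have e1 : (Finset.univ.filter fun x : V => x ≠ 0 ∧ u (g x x) = 0) = Z.erase 0 := by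
    ext x
    simp [Z]
  have e2 : (Finset.univ.filter fun w : W => w ≠ 0 ∧ u w = 0) = K.erase 0 := by
    ext w
    simp [K]
  have e3 : (Finset.univ.filter fun x : V => x ≠ 0 ∧ u (g x x) ≠ 0) = Zᶜ := by
    ext x
    simp only [Finset.mem_filter, Finset.mem_univ, true_and, Finset.mem_compl, Z,
      and_iff_right_iff_imp]
    rintro h rfl
    simp at h
  have e4 : (Finset.univ.filter fun w : W => w ≠ 0 ∧ u w ≠ 0) = Kᶜ := by
    ext w
    simp only [Finset.mem_filter, Finset.mem_univ, true_and, Finset.mem_compl, K,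
      and_iff_right_iff_imp]
    rintro h rfl
    simp at h
  have hZ0 : (0 : V) ∈ Z := by simp [Z]
  have hK0 : (0 : W) ∈ K := by simp [K]
  have hZpos := Finset.card_pos.2 ⟨_, hZ0⟩
  have hKpos := Finset.card_pos.2 ⟨_, hK0⟩
  rw [e1, e2, Finset.card_erase_of_mem hZ0, Finset.card_erase_of_mem hK0] at h1
  rw [e3, e4, Finset.card_compl, Finset.card_compl] at h2
  have hKle := Finset.card_le_univ K
  have hZle := Finset.card_le_univ Z
  have hZK : Z.card = K.card := by omega
  have hK : Nat.card {w // u w = 0} = K.card := by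
    rw [Nat.card_eq_fintype_card, Fintype.card_subtype]
  have hZ : Nat.card {x // g.compr₂ u x x = 0} = Z.card := by
    rw [Nat.card_eq_fintype_card, Fintype.card_subtype]
    rfl
  refine card_isotropic_mul_card_ne hF hV (B := g.compr₂ u) ⟨fun x y => ?_⟩ (fun x hx => ?_) ?_
  · rw [LinearMap.compr₂_apply, LinearMap.compr₂_apply, hsymm]
  · by_contra hx0
    -- Without zero divisors and in equal dimensions, `g x` is onto `W`, so `u` cannot vanish on its
    -- range. The form `u (g x y)` is thus nondegenerate.
    have hinj : Function.Injective (g x) := by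
      rw [← LinearMap.ker_eq_bot, LinearMap.ker_eq_bot']
      exact fun y hy => hg x y hy hx0
    have hsurj := (LinearMap.injective_iff_surjective_of_finrank_eq_finrank hVW).1 hinj
    apply hu
    ext w
    obtain ⟨y, rfl⟩ := hsurj w
    exact hx y
  · rw [hZ, hZK, ← hK, card_fibre_mul_card hu, Nat.card_eq_fintype_card, Nat.card_eq_fintype_card,
      hcard]

theorem sum_eq_of_forall_ne_zero {X : Type*} [Fintype X] [DecidableEq X] [Zero X] (f : X → ℕ)
    (b : ℕ) (h : ∀ x, x ≠ 0 → f x = b) : ∑ x, f x = f 0 + (Fintype.card X - 1) * b := by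
  rw [← Finset.add_sum_erase _ _ (Finset.mem_univ 0), Finset.sum_congr rfl
    (g := fun _ => b) fun x hx => h x (Finset.ne_of_mem_erase hx), Finset.sum_const,
    Finset.card_erase_of_mem (Finset.mem_univ 0), Finset.card_univ, smul_eq_mul]

theorem sum_le_of_forall_ne_zero {X : Type*} [Fintype X] [DecidableEq X] [Zero X] (f : X → ℕ)
    (b : ℕ) (h : ∀ x, x ≠ 0 → f x ≤ b) : ∑ x, f x ≤ f 0 + (Fintype.card X - 1) * b := by
  rw [← Finset.add_sum_erase _ _ (Finset.mem_univ 0)]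
  refine Nat.add_le_add_left ((Finset.sum_le_card_nsmul _ _ b
    fun x hx => h x (Finset.ne_of_mem_erase hx)).trans_eq ?_) _
  rw [Finset.card_erase_of_mem (Finset.mem_univ 0), Finset.card_univ, smul_eq_mul]

theorem le_sum_of_forall_ne_zero {X : Type*} [Fintype X] [DecidableEq X] [Zero X] (f : X → ℕ)
    (b : ℕ) (h : ∀ x, x ≠ 0 → b ≤ f x) : f 0 + (Fintype.card X - 1) * b ≤ ∑ x, f x := by
  rw [← Finset.add_sum_erase _ _ (Finset.mem_univ 0)]
  refine Nat.add_le_add_left (le_trans (Eq.le ?_) (Finset.card_nsmul_le_sum _ _ b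
    fun x hx => h x (Finset.ne_of_mem_erase hx))) _
  rw [Finset.card_erase_of_mem (Finset.mem_univ 0), Finset.card_univ, smul_eq_mul]

/-- A component of a bijective quadratic map has a degenerate polar form. -/
theorem exists_ne_zero_forall_apply_eq_zero (hcard : Nat.card V = Nat.card W)
    {g : V →ₗ[F] V →ₗ[F] W} {f : V → W} (hf : Function.Injective f)
    (hadd : ∀ x y, f (x + y) = f x + f y + g x y) {u : Module.Dual F W} (hu : u ≠ 0) :
    ∃ x, x ≠ 0 ∧ ∀ y, u (g x y) = 0 := by
  classical
  by_contra! hcon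
  have := Fintype.ofFinite V
  have hbij : Function.Bijective f := (Nat.bijective_iff_injective_and_card f).2 ⟨hf, hcard⟩
  -- Pairs with equal values of `u ∘ f` are counted twice. Bijectivity of `f` makes `u ∘ f`
  -- balanced, giving `|V|² / q`. Sorted by difference `h`, a nondegenerate polar form gives `|V| /
  -- q` for each `h ≠ 0`, but `h = 0` gives all of `|V|`, which is too many.
  have h1 : Nat.card {p : V × V // u (f p.2) = u (f p.1)} * Nat.card F =
      Nat.card V * Nat.card V := by
    have : ∀ x, Nat.card {y // u (f y) = u (f x)} * Nat.card F = Nat.card V := by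
      intro x
      rw [hcard, ← card_fibre_mul_card hu (u (f x))]
      congr 1
      exact Nat.card_congr ((Equiv.ofBijective f hbij).subtypeEquiv fun _ => Iff.rfl)
    rw [Nat.card_congr (Equiv.subtypeProdEquivSigmaSubtype fun x y => u (f y) = u (f x)),
      Nat.card_sigma, Finset.sum_mul, Finset.sum_congr rfl fun x _ => this x, Finset.sum_const,
      Finset.card_univ, smul_eq_mul, Nat.card_eq_fintype_card]
  have h2 : Nat.card {p : V × V // u (f p.2) = u (f p.1)} =
      Nat.card {p : V × V // u (f (p.1 + p.2)) = u (f p.2)} := by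
    refine Nat.card_congr
      { toFun := fun p => ⟨(p.1.2 - p.1.1, p.1.1), by simpa using p.2⟩
        invFun := fun p => ⟨(p.1.2, p.1.1 + p.1.2), p.2⟩
        left_inv := fun p => by simp
        right_inv := fun p => by simp }
  have h3 : ∀ h, h ≠ 0 → Nat.card {x // u (f (h + x)) = u (f x)} * Nat.card F =
      Nat.card V := by
    intro h hh
    have hne : u.comp (g h) ≠ 0 := by
      intro h0
      obtain ⟨y, hy⟩ := hcon h hh
      exact hy (LinearMap.congr_fun h0 y)
    rw [← card_fibre_mul_card hne (-u (f h))]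
    congr 1
    refine Nat.card_congr (Equiv.subtypeEquivRight fun x => ?_)
    rw [hadd, map_add, map_add, LinearMap.comp_apply]
    exact ⟨fun h => by linear_combination h, fun h => by linear_combination h⟩
  rw [h2, Nat.card_congr (Equiv.subtypeProdEquivSigmaSubtype
    fun h x => u (f (h + x)) = u (f x)), Nat.card_sigma, Finset.sum_mul,
    sum_eq_of_forall_ne_zero _ _ h3] at h1
  have h4 : Nat.card {x // u (f (0 + x)) = u (f x)} = Nat.card V :=
    Nat.card_congr (Equiv.subtypeUnivEquiv fun x => by rw [zero_add])
  rw [h4, Nat.card_eq_fintype_card (α := V)] at h1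
  have hq := Finite.one_lt_card (α := F)
  have hV : 0 < Fintype.card V := Fintype.card_pos
  obtain ⟨v, hv⟩ : ∃ v, Fintype.card V = v + 1 := ⟨Fintype.card V - 1, by omega⟩
  rw [hv, Nat.add_sub_cancel] at h1
  nlinarith

end Products

/-! ### Radicals of alternating forms and a double count in characteristic two -/

section EvenCharacteristic

variable {F W : Type*} [Field F] [Finite F] [AddCommGroup W] [Module F W] [Finite W] {m : ℕ}

/-- An alternating form has even rank, so for even `m` the radical has even dimension; being
nonzero, it has dimension at least two. -/
theorem sq_card_le_card_radical [CharP F 2] (hm : Even m)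
    {B : LinearMap.BilinForm F (Fin m → F)} (hsymm : ∀ x y, B x y = B y x)
    (halt : ∀ x, B x x = 0) (hrad : ∃ x, x ≠ 0 ∧ ∀ y, B x y = 0) :
    Nat.card F ^ 2 ≤ Nat.card {x // ∀ y, B x y = 0} := by
  classical
  let M : Matrix (Fin m) (Fin m) F := Matrix.of fun i j => B (Pi.single i 1) (Pi.single j 1)
  have hM : Even M.rank :=
    even_rank_of_diag_eq_zero (IsSymm.ext fun i j => hsymm _ _) fun i => halt _
  have hker : ∀ x, x ∈ LinearMap.ker M.mulVecLin ↔ ∀ y, B x y = 0 := by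
    intro x
    have h1 : ∀ i, M.mulVec x i = B x (Pi.single i 1) := by
      intro i
      rw [hsymm]
      conv_rhs => rw [pi_eq_sum_univ' x]
      simp [M, mulVec, dotProduct, mul_comm]
    rw [LinearMap.mem_ker, mulVecLin_apply]
    constructor
    · intro h y
      have h0 : B x = 0 := LinearMap.pi_ext' fun i => LinearMap.ext_ring (by
        simpa [h] using (h1 i).symm)
      rw [h0, LinearMap.zero_apply]
    · intro h
      funext i
      rw [h1, h, Pi.zero_apply]
  have hfin : M.rank + Module.finrank F (LinearMap.ker M.mulVecLin) = m := by
    have := LinearMap.finrank_range_add_finrank_ker M.mulVecLin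
    rwa [Module.finrank_fin_fun] at this
  have hpos : 0 < Module.finrank F (LinearMap.ker M.mulVecLin) := by
    obtain ⟨x, hx, h⟩ := hrad
    rw [Module.finrank_pos_iff]
    exact ⟨⟨x, (hker x).2 h⟩, 0, fun h0 => hx (congrArg Subtype.val h0)⟩
  have h2 : 2 ≤ Module.finrank F (LinearMap.ker M.mulVecLin) := by
    obtain ⟨a, ha⟩ := hM
    obtain ⟨b, hb⟩ := hm
    omega
  rw [Nat.card_congr (Equiv.subtypeEquivRight fun x => (hker x).symm)]
  change _ ≤ Nat.card (LinearMap.ker M.mulVecLin)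
  rw [Module.natCard_eq_pow_finrank (K := F) (V := LinearMap.ker M.mulVecLin)]
  exact Nat.pow_le_pow_right Nat.card_pos h2

theorem card_annihilator_le {V : Type*} [AddCommGroup V] [Module F V] [FiniteDimensional F V]
    (hVW : Module.finrank F V = Module.finrank F W) (g : V →ₗ[F] W)
    (hker : Module.finrank F (LinearMap.ker g) ≤ 1) :
    Nat.card {u : Module.Dual F W // ∀ y, u (g y) = 0} ≤ Nat.card F := by
  have h1 := LinearMap.finrank_range_add_finrank_ker g
  have h2 := Subspace.finrank_add_finrank_dualAnnihilator_eq (LinearMap.range g)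
  have h3 : Module.finrank F (LinearMap.range g).dualAnnihilator ≤ 1 := by omega
  rw [Nat.card_congr (Equiv.subtypeEquivRight (q := fun u => u ∈ (LinearMap.range g).dualAnnihilator)
    fun u => by simp [Submodule.mem_dualAnnihilator])]
  change Nat.card (LinearMap.range g).dualAnnihilator ≤ _
  rw [Module.natCard_eq_pow_finrank (K := F)]
  exact (Nat.pow_le_pow_right Nat.card_pos h3).trans_eq (pow_one _)

/-- In characteristic two and positive even dimension, a bijective quadratic map has polar form
vanishing at some pair of linearly independent vectors. -/
theorem exists_polar_eq_zero [CharP F 2] (hm : Even m) (hpos : 0 < m)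
    (hW : Module.finrank F W = m) {g : (Fin m → F) →ₗ[F] (Fin m → F) →ₗ[F] W}
    {f : (Fin m → F) → W} (hf : Function.Injective f)
    (hadd : ∀ x y, f (x + y) = f x + f y + g x y) (halt : ∀ x, g x x = 0) :
    ∃ x y, g x y = 0 ∧ x ≠ 0 ∧ ∀ s : F, y ≠ s • x := by
  classical
  by_contra! hcon
  have hsymm : ∀ x y, g x y = g y x := by
    intro x y
    have h1 := hadd x y
    rw [add_comm x y, hadd y x, add_comm (f y) (f x)] at h1
    exact (add_left_cancel h1).symm
  have hfin : Finite (Module.Dual F W) := Module.finite_of_finite F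
  have := Fintype.ofFinite (Module.Dual F W)
  have := Fintype.ofFinite F
  have hcardV : Nat.card (Fin m → F) = Nat.card F ^ m := by
    rw [Nat.card_fun, Nat.card_fin]
  have hcardW : Nat.card W = Nat.card F ^ m := by
    rw [Module.natCard_eq_pow_finrank (K := F), hW]
  have hcardD : Nat.card (Module.Dual F W) = Nat.card F ^ m := by
    rw [Module.natCard_eq_pow_finrank (K := F), Subspace.dual_finrank_eq, hW]
  -- Pairs `(u, x)` with `u ∘ g x = 0` are counted twice. Each `u ≠ 0` has at least `q²` partners by
  -- parity, each `x ≠ 0` at most `q`, since the kernel of `g x` lies in the line of `x`. The zero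
  -- rows contribute `q ^ m` on both sides.
  have h1 : ∀ u : Module.Dual F W, u ≠ 0 →
      Nat.card F ^ 2 ≤ Nat.card {x // ∀ y, u (g x y) = 0} := by
    intro u hu
    exact sq_card_le_card_radical hm (B := g.compr₂ u) (fun x y => congrArg u (hsymm x y))
      (fun x => by rw [LinearMap.compr₂_apply, halt, map_zero])
      (exists_ne_zero_forall_apply_eq_zero (hcardV.trans hcardW.symm) hf hadd hu)
  have h2 : ∀ x, x ≠ 0 →
      Nat.card {u : Module.Dual F W // ∀ y, u (g x y) = 0} ≤ Nat.card F := by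
    intro x hx
    refine card_annihilator_le (by rw [hW, Module.finrank_fin_fun]) (g x) ?_
    have hle : LinearMap.ker (g x) ≤ F ∙ x := by
      intro y hy
      obtain ⟨s, rfl⟩ := hcon x y hy hx
      exact Submodule.smul_mem _ _ (Submodule.mem_span_singleton_self x)
    exact (Submodule.finrank_mono hle).trans (finrank_span_singleton hx).le
  have e1 : Nat.card {p : Module.Dual F W × (Fin m → F) // ∀ y, p.1 (g p.2 y) = 0} =
      ∑ u : Module.Dual F W, Nat.card {x // ∀ y, u (g x y) = 0} := by
    rw [← Nat.card_sigma]
    exact Nat.card_congr (Equiv.subtypeProdEquivSigmaSubtype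
      fun (u : Module.Dual F W) (x : Fin m → F) => ∀ y, u (g x y) = 0)
  have e2 : Nat.card {p : Module.Dual F W × (Fin m → F) // ∀ y, p.1 (g p.2 y) = 0} =
      ∑ x : Fin m → F, Nat.card {u : Module.Dual F W // ∀ y, u (g x y) = 0} := by
    rw [← Nat.card_sigma]
    exact Nat.card_congr (((Equiv.prodComm _ _).subtypeEquiv fun _ => Iff.rfl).trans
      (Equiv.subtypeProdEquivSigmaSubtype
        fun (x : Fin m → F) (u : Module.Dual F W) => ∀ y, u (g x y) = 0))
  have h3 := le_sum_of_forall_ne_zero _ _ h1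
  have h4 := sum_le_of_forall_ne_zero _ _ h2
  rw [← e1] at h3
  rw [← e2] at h4
  have z1 : Nat.card {x : Fin m → F // ∀ y, (0 : Module.Dual F W) (g x y) = 0} =
      Nat.card F ^ m := by
    rw [← hcardV]
    exact Nat.card_congr (Equiv.subtypeUnivEquiv fun x y => rfl)
  have z2 : Nat.card {u : Module.Dual F W // ∀ y, u (g 0 y) = 0} = Nat.card F ^ m := by
    rw [← hcardD]
    exact Nat.card_congr (Equiv.subtypeUnivEquiv fun u y => by simp)
  rw [z1, ← Nat.card_eq_fintype_card, hcardD] at h3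
  rw [z2, ← Nat.card_eq_fintype_card, hcardV] at h4
  have hq := Finite.one_lt_card (α := F)
  have hQ : 1 < Nat.card F ^ m := Nat.one_lt_pow hpos.ne' hq
  have h5 := Nat.le_of_add_le_add_left (h3.trans h4)
  have h6 := Nat.le_of_mul_le_mul_left h5 (by omega)
  nlinarith

end EvenCharacteristic

/-! ### The quotient by a perfect code of even order, and the classification of distances -/

section Nonexistence

variable {F : Type*} [Field F] {m : ℕ}

/-- The symmetric product `x yᵀ + y xᵀ` of two vectors. -/
def symProd (F : Type*) [Field F] (m : ℕ) :
    (Fin m → F) →ₗ[F] (Fin m → F) →ₗ[F] symMatrices F m :=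
  LinearMap.mk₂ F
    (fun x y => ⟨vecMulVec x y + vecMulVec y x, by
      change (_ : Matrix _ _ F)ᵀ = _
      rw [transpose_add, transpose_vecMulVec, transpose_vecMulVec, add_comm]⟩)
    (fun x x' y => Subtype.ext (by
      ext i j
      simp [vecMulVec_apply]
      ring))
    (fun c x y => Subtype.ext (by
      ext i j
      simp [vecMulVec_apply]))
    (fun x y y' => Subtype.ext (by
      ext i j
      simp [vecMulVec_apply]
      ring))
    (fun c x y => Subtype.ext (by
      ext i j
      simp [vecMulVec_apply]))

/-- The symmetric matrix `x xᵀ`. -/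
def symSquare (x : Fin m → F) : symMatrices F m :=
  ⟨vecMulVec x x, by
    change (_ : Matrix _ _ F)ᵀ = _
    rw [transpose_vecMulVec]⟩

theorem symProd_self (x : Fin m → F) : symProd F m x x = (2 : F) • symSquare x := by
  refine Subtype.ext ?_
  ext i j
  change x i * x j + x i * x j = 2 * (x i * x j)
  ring

theorem symSquare_add (x y : Fin m → F) :
    symSquare (x + y) = symSquare x + symSquare y + symProd F m x y := by
  refine Subtype.ext ?_
  ext i j
  change (x i + y i) * (x j + y j) = x i * x j + y i * y j + (x i * y j + y i * x j)
  ring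

theorem rank_symProd_le (x y : Fin m → F) : (symProd F m x y).1.rank ≤ 2 :=
  (rank_add_le _ _).trans (Nat.add_le_add (rank_vecMulVec_le _ _) (rank_vecMulVec_le _ _))

theorem rank_smul_symSquare_le (a : F) (x : Fin m → F) : (a • symSquare x).1.rank ≤ 1 := by
  have : (a • symSquare x).1 = vecMulVec (a • x) x := by
    ext i j
    change a * (x i * x j) = a * x i * x j
    ring
  rw [this]
  exact rank_vecMulVec_le _ _

theorem exists_eq_smul_of_smul_symSquare_eq {a b : F} (ha : a ≠ 0) {x y : Fin m → F}
    (hx : x ≠ 0) (h : a • symSquare x = b • symSquare y) : ∃ s : F, x = s • y := by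
  obtain ⟨i, hi⟩ := Function.ne_iff.1 hx
  rw [Pi.zero_apply] at hi
  refine ⟨b * y i / (a * x i), ?_⟩
  funext j
  have h' : a * (x i * x j) = b * (y i * y j) := congrFun (congrFun (congrArg Subtype.val h) i) j
  rw [Pi.smul_apply, smul_eq_mul]
  field_simp
  linear_combination h'

theorem exists_eq_smul_of_symProd_eq_zero {x y : Fin m → F} (hx : x ≠ 0)
    (h : symProd F m x y = 0) : ∃ s : F, y = s • x := by
  obtain ⟨i, hi⟩ := Function.ne_iff.1 hx
  rw [Pi.zero_apply] at hi
  refine ⟨-y i / x i, ?_⟩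
  funext j
  have h' : x i * y j + y i * x j = 0 := congrFun (congrFun (congrArg Subtype.val h) i) j
  rw [Pi.smul_apply, smul_eq_mul]
  field_simp
  linear_combination h'

theorem symSquare_injective [CharP F 2] :
    Function.Injective (symSquare : (Fin m → F) → symMatrices F m) := by
  intro x y h
  funext i
  have h' : x i * x i = y i * y i := congrFun (congrFun (congrArg Subtype.val h) i) i
  rw [← sub_eq_zero]
  have : (x i - y i) * (x i - y i) = 0 := by
    have h2 : (2 : F) = 0 := CharTwo.two_eq_zero
    linear_combination h' + (y i * y i - x i * y i) * h2
  exact mul_self_eq_zero.1 this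

variable [Finite F] {C : SymCode F m}

/-- There is no perfect code of minimum distance at least three and even order. -/
theorem finrank_add_ne_of_even (hm : Even m) (hpos : 0 < m) (hC : 3 ≤ minDist C) :
    Module.finrank F C + m ≠ (m ^ 2 + m) / 2 := by
  intro hdim
  have : Finite (symMatrices F m ⧸ C) := Module.finite_of_finite F
  have hW : Module.finrank F (symMatrices F m ⧸ C) = m := by
    have := Submodule.finrank_quotient_add_finrank C
    rw [finrank_symMatrices] at this
    omega
  -- This is the only use of the distance: relations of rank at most 2 in the quotient already hold
  -- between matrices.
  have hzero : ∀ A : symMatrices F m, A.1.rank ≤ 2 → C.mkQ A = 0 → A = 0 := by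
    intro A hA h
    rw [Submodule.mkQ_apply, Submodule.Quotient.mk_eq_zero] at h
    exact eq_zero_of_rank_lt_minDist h (by omega)
  have hsq : ∀ (a b : F) (x y : Fin m → F), C.mkQ (a • symSquare x) = C.mkQ (b • symSquare y) →
      a • symSquare x = b • symSquare y := by
    intro a b x y h
    rw [← sub_eq_zero]
    refine hzero _ ?_ (by rw [map_sub, h, sub_self])
    have h1 := rank_sub_le (a • symSquare x).1 (b • symSquare y).1
    have h2 := rank_smul_symSquare_le a x
    have h3 := rank_smul_symSquare_le b y
    rw [Submodule.coe_sub]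
    omega
  have hprod : ∀ x y, (symProd F m).compr₂ C.mkQ x y = 0 → symProd F m x y = 0 :=
    fun x y h => hzero _ (rank_symProd_le x y) h
  by_cases hF : ringChar F = 2
  · have : CharP F 2 := ringChar.of_eq hF
    obtain ⟨x, y, hxy, hx, hs⟩ := exists_polar_eq_zero (g := (symProd F m).compr₂ C.mkQ)
      (f := fun x => C.mkQ (symSquare x)) hm hpos hW
      (fun x y h => symSquare_injective (by simpa using hsq 1 1 x y (by simpa using h)))
      (fun x y => by simp only [symSquare_add, map_add]; rfl)
      (fun x => by
        rw [LinearMap.compr₂_apply, symProd_self, CharTwo.two_eq_zero, zero_smul, map_zero])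
    obtain ⟨s, h⟩ := exists_eq_smul_of_symProd_eq_zero hx (hprod x y hxy)
    exact hs s h
  · have h2 : (2 : F) ≠ 0 := Ring.two_ne_zero hF
    obtain ⟨a, b, x, y, ha, hx, hxy, hs⟩ := exists_smul_square_eq_smul_square hF
      (g := (symProd F m).compr₂ C.mkQ) (by rwa [Module.finrank_fin_fun])
      (by rwa [Module.finrank_fin_fun]) (by rw [hW, Module.finrank_fin_fun])
      (fun x y => congrArg C.mkQ (Subtype.ext (add_comm _ _)))
      (fun x y h hx => by
        have h0 := hprod x y h
        obtain ⟨s, rfl⟩ := exists_eq_smul_of_symProd_eq_zero hx h0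
        obtain ⟨i, hi⟩ := Function.ne_iff.1 hx
        have h' : x i * (s * x i) + s * x i * x i = 0 :=
          congrFun (congrFun (congrArg Subtype.val h0) i) i
        have h3 : (2 * (x i * x i)) * s = 0 := by linear_combination h'
        have hs := (mul_eq_zero.1 h3).resolve_left (mul_ne_zero h2 (mul_ne_zero hi hi))
        rw [hs, zero_smul])
    -- The product of `x` with itself is `2 x xᵀ`, hence the factors 2; they are harmless in odd
    -- characteristic.
    have h3 : C.mkQ ((a * 2) • symSquare x) = C.mkQ ((b * 2) • symSquare y) := by
      rw [mul_smul, mul_smul, ← symProd_self, ← symProd_self, map_smul, map_smul]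
      exact hxy
    obtain ⟨s, h⟩ := exists_eq_smul_of_smul_symSquare_eq (mul_ne_zero ha h2) hx
      (hsq _ _ x y h3)
    exact hs s h

theorem finite_setOf_even_order {C : CodeFamily F 3} (hC : C.IsQuasiPerfect) :
    {i : ℕ | Even (C.order i)}.Finite := by
  have h := finrank_add_order_of_isQuasiPerfect (by norm_num) hC
  rw [← Nat.cofinite_eq_atTop, Filter.eventually_cofinite] at h
  refine h.subset fun i hi => ?_
  have h1 := minDist_le_order (C.code_ne_bot i)
  have h2 := C.minDist_code i
  exact finrank_add_ne_of_even hi (by omega) h2.ge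

theorem exists_isQuasiPerfect_iff (F : Type*) [Field F] [Finite F] (d : ℕ) :
    (∃ C : CodeFamily F d, C.IsQuasiPerfect) ↔ d ∈ ({1, 3} : Set ℕ) := by
  constructor
  · rintro ⟨C, hC⟩
    rcases (show d = 0 ∨ d = 1 ∨ d = 2 ∨ d = 3 ∨ d = 4 ∨ 5 ≤ d by omega) with
      rfl | rfl | rfl | rfl | rfl | hd
    · exact absurd hC (not_isQuasiPerfect_zero C)
    · simp
    · exact absurd hC (not_isQuasiPerfect_two C)
    · simp
    · exact absurd hC (not_isQuasiPerfect_four C)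
    · exact absurd hC (not_isQuasiPerfect_of_five_le hd C)
  · rintro (rfl | rfl)
    · exact exists_isQuasiPerfect_one F
    · exact exists_isQuasiPerfect_three F

end Nonexistence

end SymRank

theorem mainTheorem2 (F : Type*) [Field F] [Finite F] :
    (∀ d : ℕ, (∃ C : SymRank.CodeFamily F d, C.IsQuasiPerfect) ↔ d ∈ ({1, 3} : Set ℕ)) ∧
    (∀ C : SymRank.CodeFamily F 3, C.IsQuasiPerfect → {i : ℕ | Even (C.order i)}.Finite) ∧
    (∀ m : ℕ, Odd m → 3 ≤ m →
      ∃ C : SymRank.SymCode F m, SymRank.IsSymMRD C ∧ SymRank.minDist C = 3) ∧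
    (∀ C : SymRank.CodeFamily F 3,
      (∀ i : ℕ, Odd (C.order i) ∧ SymRank.IsSymMRD (C.code i)) → C.IsQuasiPerfect) :=
  ⟨SymRank.exists_isQuasiPerfect_iff F, fun _ hC => SymRank.finite_setOf_even_order hC,
    fun _ hm h3 => SymRank.exists_isSymMRD_three F hm h3,
    fun C h => SymRank.isQuasiPerfect_of_isSymMRD C h⟩
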